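/- **Conventions.** $\lambda$ is Lebesgue measure on $[0,1]$, functions are real valued and identified when they agree $\lambda$-a.e. A *Banach function space* (B.f.s.) on $[0,1]$ is a Banach space $X$ of classes of measurable functions such that $f\in X$ and $|g|\le|f|$ a.e. imply $g\in X$ and $\|g\|_X\le\|f\|_X$. A function space is *rearrangement invariant* if $f\in X$ and $g^*\le f^*$ imply $g\in X$ and $\|g\|_X\le\|f\|_X$, where $f^*$, the decreasing rearrangement, is the right-continuous inverse of $\tau\mapsto\lambda(\{|f|>\tau\})$. An *r.i. space* is a nonzero B.f.s. that is rearrangement invariant (the Fatou property is not assumed). Let $\mathcal C f(x)=\frac1x\int_0^x f(t)\,dt$, and $$[\mathcal C,X]=\{f:\ \mathcal C(|f|)\in X\},\qquad \|f\|_{[\mathcal C,X]}=\|\mathcal C(|f|)\|_X .$$ For an r.i. space $X\ne L^\infty$, the set function $m_X(A)=\mathcal C(\chi_A)$ is a $\sigma$-additive $X$-valued vector measure, with the same null sets as $\lambda$. The space $L^1(m_X)$ consists of all measurable $f$ that are integrable with respect to $|x^*m_X|$ for every $x^*\in X^*$ and such that for each measurable $A$ there is a vector $\int_A f\,dm_X\in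 X$ with $\langle \int_A f\,dm_X,x^*\rangle=\int_A f\,d(x^*m_X)$ for all $x^*\in X^*$; its norm is $\|f\|_{L^1(m_X)}=\sup_{\|x^*\|\le1}\int|f|\,d|x^*m_X|$. For a space $Y$ of functions, $Y_a=\{f\in Y:\ \lim_{\lambda(A)\to0}\|f\chi_A\|_Y=0\}$ is its absolutely continuous part. **Theorem.** Let $X$ be an r.i. space on $[0,1]$ with $X\neq L^\infty$. (a) The space $L^1(m_X)$ is not reflexive, and the Cesàro space $[\mathcal C,X]$ is not reflexive either. (b) $L^1(m_X)=[\mathcal C,X]_a$, with equal norms, and neither $[\mathcal C,X]$ nor $L^1(m_X)$ is rearrangement invariant. Moreover, neither of them coincides, as a set of functions, with an r.i. space (so neither is r.i. under any other norm). -/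

import Mathlib

open MeasureTheory Set Filter
open scoped ENNReal NNReal Topology

noncomputable section

/-- A normed space is reflexive if the canonical embedding into its bidual is onto. -/
def IsReflexive (E : Type*) [NormedAddCommGroup E] [NormedSpace ℝ E] : Prop :=
  Function.Surjective (NormedSpace.inclusionInDoubleDual ℝ E)

section FunctionSpaces

variable {Ω : Type*} [MeasurableSpace Ω] {μ : Measure Ω}

/-- A normed space of `μ`-classes of real measurable functions: a linear subspace `carrier`
with a norm `nrm` on it. The values of `nrm` outside `carrier` carry no information. -/
structure NormedFunctionSpace (μ : Measure Ω) where
  carrier : Submodule ℝ (Ω →ₘ[μ] ℝ)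
  nrm : (Ω →ₘ[μ] ℝ) → ℝ
  nrm_nonneg : ∀ f ∈ carrier, 0 ≤ nrm f
  nrm_add_le : ∀ f ∈ carrier, ∀ g ∈ carrier, nrm (f + g) ≤ nrm f + nrm g
  nrm_smul : ∀ c : ℝ, ∀ f ∈ carrier, nrm (c • f) = |c| * nrm f
  eq_zero_of_nrm_eq_zero : ∀ f ∈ carrier, nrm f = 0 → f = 0

namespace NormedFunctionSpace

/-- The elements of `X`, as a type. -/
def Elem (X : NormedFunctionSpace μ) : Type _ := X.carrier

instance (X : NormedFunctionSpace μ) : AddCommGroup X.Elem :=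
  inferInstanceAs (AddCommGroup X.carrier)

instance (X : NormedFunctionSpace μ) : Module ℝ X.Elem :=
  inferInstanceAs (Module ℝ X.carrier)

instance (X : NormedFunctionSpace μ) : Norm X.Elem := ⟨fun f => X.nrm (Subtype.val f)⟩

theorem core (X : NormedFunctionSpace μ) : NormedSpace.Core ℝ X.Elem where
  norm_nonneg f := X.nrm_nonneg _ f.2
  norm_smul c f := X.nrm_smul c _ f.2
  norm_triangle f g := X.nrm_add_le _ f.2 _ g.2
  norm_eq_zero_iff f := by
    refine ⟨fun h => Subtype.ext (X.eq_zero_of_nrm_eq_zero _ f.2 h), fun h => ?_⟩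
    have := X.nrm_smul 0 _ f.2
    rw [zero_smul, abs_zero, zero_mul] at this
    rw [h]; exact this

instance (X : NormedFunctionSpace μ) : NormedAddCommGroup X.Elem :=
  NormedAddCommGroup.ofCore X.core

instance (X : NormedFunctionSpace μ) : NormedSpace ℝ X.Elem :=
  NormedSpace.ofCore X.core

/-- Banach function spaces: the ideal property, and completeness in the norm. -/
structure IsBanachFunctionSpace (X : NormedFunctionSpace μ) : Prop where
  ideal : ∀ f ∈ X.carrier, ∀ g : Ω →ₘ[μ] ℝ, (∀ᵐ x ∂μ, |g x| ≤ |f x|) →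
    g ∈ X.carrier ∧ X.nrm g ≤ X.nrm f
  complete : CompleteSpace X.Elem

end NormedFunctionSpace

/-- The distribution function `τ ↦ μ {|f| > τ}`. -/
def distributionFun (f : Ω →ₘ[μ] ℝ) (τ : ℝ≥0∞) : ℝ≥0∞ := μ {x | τ < ‖f x‖ₑ}

/-- The decreasing rearrangement `f*`, the right continuous inverse of the distribution
function; it takes the value `ess sup |f|`, possibly infinite, at `0`. -/
def decreasingRearrangement (f : Ω →ₘ[μ] ℝ) (s : ℝ≥0∞) : ℝ≥0∞ :=
  sInf {τ | distributionFun f τ ≤ s}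

/-- The class of the characteristic function of a measurable set. -/
def charClass (A : Set Ω) (hA : MeasurableSet A) : Ω →ₘ[μ] ℝ :=
  AEEqFun.mk (A.indicator fun _ => (1 : ℝ))
    (stronglyMeasurable_const.indicator hA).aestronglyMeasurable

namespace NormedFunctionSpace

/-- `g* ≤ f*` and `f ∈ X` imply `g ∈ X` and `‖g‖ ≤ ‖f‖`. -/
def IsRearrangementInvariant (X : NormedFunctionSpace μ) : Prop :=
  ∀ f ∈ X.carrier, ∀ g : Ω →ₘ[μ] ℝ,
    (∀ s, decreasingRearrangement g s ≤ decreasingRearrangement f s) →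
      g ∈ X.carrier ∧ X.nrm g ≤ X.nrm f

/-- Rearrangement invariant spaces: nonzero rearrangement invariant Banach function spaces. -/
structure IsRISpace (X : NormedFunctionSpace μ) : Prop extends X.IsBanachFunctionSpace where
  ne_bot : X.carrier ≠ ⊥
  rearrangementInvariant : X.IsRearrangementInvariant

/-- The absolutely continuous part: all `f ∈ X` with `‖f χ_A‖ → 0` as `μ A → 0`. -/
def acPart (X : NormedFunctionSpace μ) : Set (Ω →ₘ[μ] ℝ) :=
  {f | f ∈ X.carrier ∧ ∀ ε > 0, ∃ δ > 0, ∀ (A : Set Ω) (hA : MeasurableSet A),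
    μ A < δ → X.nrm (f * charClass A hA) < ε}

end NormedFunctionSpace

end FunctionSpaces

section VectorMeasures

variable {Ω : Type*} [MeasurableSpace Ω] {E : Type*} [NormedAddCommGroup E] [NormedSpace ℝ E]

/-- The signed measure `A ↦ ⟨x*, m A⟩`. -/
def dualMeasure (m : VectorMeasure Ω E) (φ : StrongDual ℝ E) : SignedMeasure Ω :=
  m.mapRange (φ : E →+ ℝ) φ.continuous

/-- A measurable set `A` is `m`-null if `|x*m|(A) = 0` for all `x*`. -/
def IsVectorNull (m : VectorMeasure Ω E) (A : Set Ω) : Prop :=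
  ∀ φ : StrongDual ℝ E, (dualMeasure m φ).variation A = 0

/-- Integrability of `f` with respect to the vector measure `m`: `f` is integrable for every
`|x*m|`, and the integral of `f` over each measurable set exists as a vector of `E`. -/
def VectorIntegrable (m : VectorMeasure Ω E) (f : Ω → ℝ) : Prop :=
  (∀ φ : StrongDual ℝ E, Integrable f (dualMeasure m φ).variation) ∧
  ∀ A, MeasurableSet A → ∃ v : E, ∀ φ : StrongDual ℝ E,
    φ v = ∫ᵛ x in A, f x ∂•(dualMeasure m φ)

/-- The supremum of `∫ |f| d|x*m|` over the unit ball of the dual. -/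
def vectorENorm (m : VectorMeasure Ω E) (f : Ω → ℝ) : ℝ≥0∞ :=
  ⨆ φ ∈ {φ : StrongDual ℝ E | ‖φ‖ ≤ 1}, ∫⁻ x, ‖f x‖ₑ ∂(dualMeasure m φ).variation

theorem dualMeasure_apply (m : VectorMeasure Ω E) (φ : StrongDual ℝ E) (A : Set Ω) :
    dualMeasure m φ A = φ (m A) := rfl

theorem dualMeasure_add (m : VectorMeasure Ω E) (φ ψ : StrongDual ℝ E) :
    dualMeasure m (φ + ψ) = dualMeasure m φ + dualMeasure m ψ := by
  ext A; rfl

theorem dualMeasure_smul (m : VectorMeasure Ω E) (c : ℝ) (φ : StrongDual ℝ E) :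
    dualMeasure m (c • φ) = c • dualMeasure m φ := by
  ext A; rfl

theorem variation_dualMeasure_univ_le (m : VectorMeasure Ω E) (φ : StrongDual ℝ E) :
    (dualMeasure m φ).variation univ ≤ ‖φ‖ₑ * m.bound := by
  by_cases h0 : φ = 0
  · have : dualMeasure m φ = 0 := by ext A; simp [h0, dualMeasure_apply]
    simp [this]
  have hn : ‖φ‖ ≠ 0 := norm_ne_zero_iff.2 h0
  set ψ : StrongDual ℝ E := ‖φ‖⁻¹ • φ with hψ
  have h1 : ‖ψ‖ₑ ≤ 1 := by
    rw [hψ, enorm_smul, enorm_inv hn]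
    simp only [enorm_norm]
    exact ENNReal.inv_mul_le_one _
  have h2 : φ = ‖φ‖ • ψ := by rw [hψ, smul_smul, mul_inv_cancel₀ hn, one_smul]
  have h3 : (dualMeasure m ψ).variation univ ≤ m.bound := by
    refine le_trans ?_ (VectorMeasure.semivariation_apply_le_bound (μ := m) (s := univ))
    exact le_biSup (fun ℓ : StrongDual ℝ E =>
      (m.mapRange (ℓ : E →+ ℝ) ℓ.continuous).variation univ) h1
  conv_lhs => rw [h2, dualMeasure_smul, VectorMeasure.variation_smul]
  simp only [Measure.smul_apply, nnnorm_norm]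
  exact mul_le_mul_right h3 _

theorem lintegral_dualMeasure_add_le (m : VectorMeasure Ω E) (g : Ω → ℝ≥0∞)
    (φ ψ : StrongDual ℝ E) :
    ∫⁻ x, g x ∂(dualMeasure m (φ + ψ)).variation ≤
      ∫⁻ x, g x ∂(dualMeasure m φ).variation + ∫⁻ x, g x ∂(dualMeasure m ψ).variation := by
  rw [dualMeasure_add, ← lintegral_add_measure]
  exact lintegral_mono' VectorMeasure.variation_add_le le_rfl

theorem lintegral_dualMeasure_smul (m : VectorMeasure Ω E) (g : Ω → ℝ≥0∞) (c : ℝ)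
    (φ : StrongDual ℝ E) :
    ∫⁻ x, g x ∂(dualMeasure m (c • φ)).variation =
      ‖c‖ₑ * ∫⁻ x, g x ∂(dualMeasure m φ).variation := by
  rw [dualMeasure_smul, VectorMeasure.variation_smul, lintegral_smul_measure]
  rfl

/-- The supremum defining the norm is finite, by uniform boundedness. -/
theorem vectorENorm_ne_top (m : VectorMeasure Ω E) {f : Ω → ℝ} (hf : Measurable f)
    (hint : ∀ φ : StrongDual ℝ E, Integrable f (dualMeasure m φ).variation) :
    vectorENorm m f ≠ ∞ := by
  have hfin : ∀ φ : StrongDual ℝ E,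
      ∫⁻ x, ‖f x‖ₑ ∂(dualMeasure m φ).variation ≠ ∞ := fun φ => (hint φ).2.ne
  let g : ℕ → Ω → ℝ≥0∞ := fun n x => min ‖f x‖ₑ n
  have hg : ∀ n φ, ∫⁻ x, g n x ∂(dualMeasure m φ).variation ≤
      ∫⁻ x, ‖f x‖ₑ ∂(dualMeasure m φ).variation :=
    fun n φ => lintegral_mono fun x => min_le_left _ _
  have hgfin : ∀ n φ, ∫⁻ x, g n x ∂(dualMeasure m φ).variation ≠ ∞ :=
    fun n φ => ne_top_of_le_ne_top (hfin φ) (hg n φ)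
  have mk : ∀ G : Ω → ℝ≥0∞, (∀ φ, ∫⁻ x, G x ∂(dualMeasure m φ).variation ≠ ∞) →
      ∃ p : Seminorm ℝ (StrongDual ℝ E),
        ∀ φ, p φ = (∫⁻ x, G x ∂(dualMeasure m φ).variation).toReal := by
    intro G hG
    refine ⟨Seminorm.of (fun φ => (∫⁻ x, G x ∂(dualMeasure m φ).variation).toReal) ?_ ?_,
      fun φ => rfl⟩
    · intro φ ψ
      rw [← ENNReal.toReal_add (hG _) (hG _)]
      exact ENNReal.toReal_mono (ENNReal.add_ne_top.2 ⟨hG _, hG _⟩)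
        (lintegral_dualMeasure_add_le m G φ ψ)
    · intro c φ
      rw [lintegral_dualMeasure_smul, ENNReal.toReal_mul]
      simp
  choose p hp using fun n => mk (g n) (hgfin n)
  obtain ⟨q, hq⟩ := mk (fun x => ‖f x‖ₑ) hfin
  have hpq : ∀ n, p n ≤ q := fun n φ => by
    rw [hp, hq]; exact ENNReal.toReal_mono (hfin φ) (hg n φ)
  have hbdd : BddAbove (range p) := ⟨q, by rintro _ ⟨n, rfl⟩; exact hpq n⟩
  have hcont : ∀ n, Continuous (p n) := by
    intro n
    refine Seminorm.continuous_of_le (q := (n * m.bound : ℝ≥0) • normSeminorm ℝ _) ?_ ?_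
    · exact (continuous_const.mul continuous_norm)
    · intro φ
      rw [hp]
      have h1 : ∫⁻ x, g n x ∂(dualMeasure m φ).variation ≤ n * (‖φ‖ₑ * m.bound) := by
        refine (lintegral_mono (g := fun _ => (n : ℝ≥0∞)) fun x => min_le_right _ _).trans ?_
        rw [lintegral_const]
        exact mul_le_mul_right (variation_dualMeasure_univ_le m φ) _
      refine (ENNReal.toReal_mono (by finiteness) h1).trans (le_of_eq ?_)
      simp only [ENNReal.toReal_mul, ENNReal.toReal_natCast, toReal_enorm,
        ENNReal.coe_toReal, smul_apply, coe_normSeminorm, NNReal.smul_def, smul_eq_mul]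
      push_cast
      ring
  have hsup := Seminorm.continuous_iSup p hcont hbdd
  rw [← Seminorm.coe_iSup_eq hbdd] at hsup
  obtain ⟨C, hC0, hC⟩ := Seminorm.bound_of_continuous_normedSpace _ hsup
  refine ne_top_of_le_ne_top (b := ENNReal.ofReal C) ENNReal.ofReal_ne_top ?_
  refine iSup₂_le fun φ hφ => ?_
  have hmono : ∫⁻ x, ‖f x‖ₑ ∂(dualMeasure m φ).variation =
      ⨆ n, ∫⁻ x, g n x ∂(dualMeasure m φ).variation := by
    rw [← lintegral_iSup]
    · refine lintegral_congr fun x => ?_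
      refine le_antisymm ?_ (iSup_le fun n => min_le_left _ _)
      obtain ⟨n, hn⟩ := ENNReal.exists_nat_gt (enorm_ne_top (x := f x))
      exact le_iSup_of_le n (by simp [g, hn.le])
    · exact fun n => hf.enorm.min measurable_const
    · intro a b hab x
      exact min_le_min_left _ (by exact_mod_cast hab)
  rw [hmono]
  refine iSup_le fun n => ?_
  rw [← ENNReal.ofReal_toReal (hgfin n φ), ← hp]
  refine ENNReal.ofReal_le_ofReal ?_
  calc p n φ ≤ (⨆ n, p n) φ := le_ciSup hbdd n φ
    _ ≤ C * ‖φ‖ := hC φ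
    _ ≤ C := by nlinarith [show ‖φ‖ ≤ 1 from hφ]

theorem variation_dualMeasure_ac {m : VectorMeasure Ω E} {μ : Measure Ω}
    (h : ∀ A, MeasurableSet A → (IsVectorNull m A ↔ μ A = 0)) (φ : StrongDual ℝ E) :
    (dualMeasure m φ).variation ≪ μ :=
  Measure.AbsolutelyContinuous.mk fun A hA h0 => (h A hA).2 h0 φ

theorem VectorIntegrable.congr {m : VectorMeasure Ω E} {f g : Ω → ℝ}
    (hfg : ∀ φ : StrongDual ℝ E, f =ᵐ[(dualMeasure m φ).variation] g)
    (hf : VectorIntegrable m f) : VectorIntegrable m g := by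
  refine ⟨fun φ => (hf.1 φ).congr (hfg φ), fun A hA => ?_⟩
  obtain ⟨v, hv⟩ := hf.2 A hA
  refine ⟨v, fun φ => (hv φ).trans ?_⟩
  exact VectorMeasure.setIntegral_congr_ae ((hfg φ).mono fun x hx _ => hx)

theorem VectorIntegrable.add {m : VectorMeasure Ω E} {f g : Ω → ℝ}
    (hf : VectorIntegrable m f) (hg : VectorIntegrable m g) :
    VectorIntegrable m (fun x => f x + g x) := by
  refine ⟨fun φ => (hf.1 φ).add (hg.1 φ), fun A hA => ?_⟩
  obtain ⟨v, hv⟩ := hf.2 A hA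
  obtain ⟨w, hw⟩ := hg.2 A hA
  refine ⟨v + w, fun φ => ?_⟩
  rw [map_add, hv, hw, ← VectorMeasure.integral_fun_add]
  · exact VectorMeasure.Integrable.restrict (hf.1 φ)
  · exact VectorMeasure.Integrable.restrict (hg.1 φ)

theorem VectorIntegrable.smul {m : VectorMeasure Ω E} {f : Ω → ℝ} (c : ℝ)
    (hf : VectorIntegrable m f) : VectorIntegrable m (fun x => c • f x) := by
  refine ⟨fun φ => (hf.1 φ).smul c, fun A hA => ?_⟩
  obtain ⟨v, hv⟩ := hf.2 A hA
  refine ⟨c • v, fun φ => ?_⟩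
  rw [map_smul, hv, VectorMeasure.integral_fun_smul]

theorem vectorENorm_congr {m : VectorMeasure Ω E} {f g : Ω → ℝ}
    (hfg : ∀ φ : StrongDual ℝ E, f =ᵐ[(dualMeasure m φ).variation] g) :
    vectorENorm m f = vectorENorm m g := by
  refine iSup_congr fun φ => iSup_congr fun _ => lintegral_congr_ae ?_
  exact (hfg φ).mono fun x hx => by simp only [hx]

/-- The space `L¹(m)` of a vector measure `m` whose null sets are those of `μ`, so that
classes of functions modulo `m`-null sets are classes modulo `μ`-null sets. -/
def vectorL1 (m : VectorMeasure Ω E) (μ : Measure Ω)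
    (h : ∀ A, MeasurableSet A → (IsVectorNull m A ↔ μ A = 0)) : NormedFunctionSpace μ where
  carrier :=
    { carrier := {f | VectorIntegrable m f}
      zero_mem' := by
        have h0 : VectorIntegrable m (fun _ : Ω => (0 : ℝ)) :=
          ⟨fun φ => integrable_zero _ _ _, fun A hA => ⟨0, fun φ => by simp⟩⟩
        exact h0.congr fun φ =>
          (variation_dualMeasure_ac h φ).ae_eq AEEqFun.coeFn_zero.symm
      add_mem' := fun {f g} hf hg => (VectorIntegrable.add hf hg).congr fun φ =>
        (variation_dualMeasure_ac h φ).ae_eq (AEEqFun.coeFn_add f g).symm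
      smul_mem' := fun c f hf => (VectorIntegrable.smul c hf).congr fun φ =>
        (variation_dualMeasure_ac h φ).ae_eq (AEEqFun.coeFn_smul c f).symm }
  nrm f := (vectorENorm m f).toReal
  nrm_nonneg f _ := ENNReal.toReal_nonneg
  nrm_add_le f hf g hg := by
    have hf' := vectorENorm_ne_top m f.stronglyMeasurable.measurable hf.1
    have hg' := vectorENorm_ne_top m g.stronglyMeasurable.measurable hg.1
    rw [← ENNReal.toReal_add hf' hg']
    refine ENNReal.toReal_mono (ENNReal.add_ne_top.2 ⟨hf', hg'⟩) ?_
    rw [vectorENorm_congr fun φ => (variation_dualMeasure_ac h φ).ae_eq (AEEqFun.coeFn_add f g)]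
    refine iSup₂_le fun φ hφ => ?_
    refine (lintegral_mono (g := fun x => ‖f x‖ₑ + ‖g x‖ₑ) fun x => enorm_add_le _ _).trans ?_
    rw [lintegral_add_left f.stronglyMeasurable.measurable.enorm]
    exact add_le_add
      (le_iSup₂ (f := fun φ (_ : φ ∈ {φ : StrongDual ℝ E | ‖φ‖ ≤ 1}) =>
        ∫⁻ x, ‖f x‖ₑ ∂(dualMeasure m φ).variation) φ hφ)
      (le_iSup₂ (f := fun φ (_ : φ ∈ {φ : StrongDual ℝ E | ‖φ‖ ≤ 1}) =>
        ∫⁻ x, ‖g x‖ₑ ∂(dualMeasure m φ).variation) φ hφ)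
  nrm_smul c f hf := by
    rw [vectorENorm_congr fun φ => (variation_dualMeasure_ac h φ).ae_eq (AEEqFun.coeFn_smul c f)]
    have : vectorENorm m (c • (f : Ω → ℝ)) = ‖c‖ₑ * vectorENorm m f := by
      simp only [vectorENorm, ENNReal.mul_iSup]
      refine iSup_congr fun φ => iSup_congr fun _ => ?_
      rw [← lintegral_const_mul _ f.stronglyMeasurable.measurable.enorm]
      simp only [Pi.smul_apply, enorm_smul]
    rw [this, ENNReal.toReal_mul, toReal_enorm, Real.norm_eq_abs]
  eq_zero_of_nrm_eq_zero f hf h0 := by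
    have h1 : vectorENorm m f = 0 := by
      rcases (ENNReal.toReal_eq_zero_iff _).1 h0 with h | h
      · exact h
      · exact absurd h (vectorENorm_ne_top m f.stronglyMeasurable.measurable hf.1)
    have hA : MeasurableSet {x | f x ≠ 0} :=
      f.stronglyMeasurable.measurable (measurableSet_singleton (0 : ℝ)).compl
    have h2 : ∀ φ : StrongDual ℝ E, ∫⁻ x, ‖f x‖ₑ ∂(dualMeasure m φ).variation = 0 := by
      intro φ
      by_cases hφ : φ = 0
      · have : dualMeasure m φ = 0 := by ext A; simp [hφ, dualMeasure_apply]
        simp [this]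
      have hn : ‖φ‖ ≠ 0 := norm_ne_zero_iff.2 hφ
      have h3 : ∫⁻ x, ‖f x‖ₑ ∂(dualMeasure m (‖φ‖⁻¹ • φ)).variation = 0 := by
        refine le_antisymm (h1 ▸ le_iSup₂ (f := fun φ
          (_ : φ ∈ {φ : StrongDual ℝ E | ‖φ‖ ≤ 1}) =>
            ∫⁻ x, ‖f x‖ₑ ∂(dualMeasure m φ).variation) _ ?_) (zero_le)
        simp [norm_smul, inv_mul_cancel₀ hn]
      rw [lintegral_dualMeasure_smul] at h3
      rcases mul_eq_zero.1 h3 with h4 | h4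
      · exact absurd (enorm_eq_zero.1 h4) (inv_ne_zero hn)
      · exact h4
    have h3 : IsVectorNull m {x | f x ≠ 0} := by
      intro φ
      have := (lintegral_eq_zero_iff f.stronglyMeasurable.measurable.enorm).1 (h2 φ)
      exact ae_iff.1 (this.mono fun x hx => by simpa using hx)
    have h4 := (h _ hA).1 h3
    refine AEEqFun.ext (EventuallyEq.trans ?_ AEEqFun.coeFn_zero.symm)
    exact h4

end VectorMeasures

section Cesaro

open unitInterval

/-- The Cesàro operator `(C f)(x) = (1 / x) ∫₀ˣ f(t) dt` on classes of functions on `[0,1]`. -/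
def cesaro (f : I →ₘ[volume] ℝ) : I →ₘ[volume] ℝ :=
  AEEqFun.mk (fun x : I => (x : ℝ)⁻¹ * ∫ t in Iic x, f t) (by
    refine StronglyMeasurable.aestronglyMeasurable ?_
    refine (measurable_subtype_coe.inv.stronglyMeasurable).mul ?_
    have h : StronglyMeasurable (Function.uncurry
        fun (x t : I) => (Iic x).indicator (fun t => f t) t) := by
      have : (Function.uncurry fun (x t : I) => (Iic x).indicator (fun t => f t) t) =
          {p : I × I | p.2 ≤ p.1}.indicator (fun p => f p.2) := by
        ext ⟨x, t⟩
        simp only [Function.uncurry_apply_pair, indicator, mem_Iic, mem_ofPred_eq]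
      rw [this]
      exact (f.stronglyMeasurable.comp_measurable measurable_snd).indicator
        (measurableSet_le measurable_snd measurable_fst)
    simpa only [integral_indicator measurableSet_Iic] using
      h.integral_prod_right (ν := (volume : Measure I)))

theorem cesaro_coe (f : I →ₘ[volume] ℝ) :
    cesaro f =ᵐ[volume] fun x : I => (x : ℝ)⁻¹ * ∫ t in Iic x, f t :=
  AEEqFun.coeFn_mk _ _

/-- `C |f|` is finite almost everywhere. -/
def CesaroFinite (f : I →ₘ[volume] ℝ) : Prop :=
  ∀ᵐ x : I, IntegrableOn f (Iic x)

theorem cesaro_abs_coe (f : I →ₘ[volume] ℝ) :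
    cesaro |f| =ᵐ[volume] fun x : I => (x : ℝ)⁻¹ * ∫ t in Iic x, |f t| := by
  filter_upwards [cesaro_coe |f|] with x hx
  rw [hx]
  congr 1
  exact integral_congr_ae (ae_restrict_of_ae (AEEqFun.coeFn_abs f))

theorem cesaro_abs_nonneg (f : I →ₘ[volume] ℝ) : ∀ᵐ x : I, 0 ≤ cesaro |f| x := by
  filter_upwards [cesaro_abs_coe f] with x hx
  rw [hx]
  exact mul_nonneg (inv_nonneg.2 x.2.1) (integral_nonneg fun t => abs_nonneg _)

theorem CesaroFinite.add {f g : I →ₘ[volume] ℝ} (hf : CesaroFinite f) (hg : CesaroFinite g) :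
    CesaroFinite (f + g) := by
  filter_upwards [hf, hg] with x h1 h2
  exact (h1.add h2).congr (ae_restrict_of_ae (AEEqFun.coeFn_add f g).symm)

theorem cesaro_abs_add_le {f g : I →ₘ[volume] ℝ} (hf : CesaroFinite f) (hg : CesaroFinite g) :
    ∀ᵐ x : I, |cesaro |f + g| x| ≤ |(cesaro |f| + cesaro |g|) x| := by
  filter_upwards [hf, hg, cesaro_abs_coe f, cesaro_abs_coe g, cesaro_abs_coe (f + g),
    AEEqFun.coeFn_add (cesaro |f|) (cesaro |g|), cesaro_abs_nonneg (f + g)]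
    with x h1 h2 e1 e2 e3 e4 h3
  rw [abs_of_nonneg h3]
  refine le_trans ?_ (le_abs_self _)
  rw [e3, e4, Pi.add_apply, e1, e2, ← mul_add,
    ← integral_add h1.abs h2.abs]
  refine mul_le_mul_of_nonneg_left ?_ (inv_nonneg.2 x.2.1)
  refine integral_mono_of_nonneg (ae_of_all _ fun t => abs_nonneg _) (h1.abs.add h2.abs) ?_
  filter_upwards [ae_restrict_of_ae (AEEqFun.coeFn_add f g)] with t ht
  rw [ht]
  exact abs_add_le _ _

theorem cesaro_abs_smul (c : ℝ) (f : I →ₘ[volume] ℝ) :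
    cesaro |c • f| = |c| • cesaro |f| := by
  refine AEEqFun.ext ?_
  filter_upwards [cesaro_abs_coe f, cesaro_abs_coe (c • f),
    AEEqFun.coeFn_smul |c| (cesaro |f|)] with x e1 e2 e3
  rw [e2, e3, Pi.smul_apply, e1, smul_eq_mul, ← mul_assoc, mul_comm |c|, mul_assoc,
    ← integral_const_mul |c|]
  congr 1
  refine integral_congr_ae ?_
  filter_upwards [ae_restrict_of_ae (AEEqFun.coeFn_smul c f)] with t ht
  rw [ht, Pi.smul_apply, smul_eq_mul, abs_mul]

theorem eq_zero_of_cesaro_abs_eq_zero {f : I →ₘ[volume] ℝ} (hf : CesaroFinite f)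
    (h : cesaro |f| = 0) : f = 0 := by
  have h1 : ∀ᵐ x : I, ∀ᵐ t ∂(volume.restrict (Iic x)), f t = 0 := by
    have h0 : ∀ᵐ x : I, x ≠ 0 := by
      rw [ae_iff]; simp
    filter_upwards [hf, cesaro_abs_coe f, h ▸ AEEqFun.coeFn_zero (β := ℝ), h0]
      with x e1 e2 e3 e4
    rw [e3, Pi.zero_apply] at e2
    have hx : (x : ℝ) ≠ 0 := fun hx => e4 (Subtype.ext hx)
    have e5 := (mul_eq_zero.1 e2.symm).resolve_left (inv_ne_zero hx)
    have := (integral_eq_zero_iff_of_nonneg (fun t => abs_nonneg _) e1.abs).1 e5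
    filter_upwards [this] with t ht
    simpa using ht
  have h2 : ∀ n : ℕ, ∃ x : I, (∀ᵐ t ∂(volume.restrict (Iic x)), f t = 0) ∧
      1 - 1 / ((n : ℝ) + 1) < x := by
    intro n
    have hmem : (1 - 1 / ((n : ℝ) + 1)) ∈ I := by
      have h0 : (0 : ℝ) < (n : ℝ) + 1 := by positivity
      constructor
      · rw [sub_nonneg, div_le_one h0]; linarith [(Nat.cast_nonneg n : (0 : ℝ) ≤ n)]
      · have : 0 ≤ 1 / ((n : ℝ) + 1) := by positivity
        linarith
    have hpos : (volume : Measure I) (Ioi ⟨_, hmem⟩) ≠ 0 := by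
      rw [unitInterval.volume_Ioi]
      simp only [ne_eq, ENNReal.ofReal_eq_zero, not_le]
      have : 0 < 1 / ((n : ℝ) + 1) := by positivity
      linarith
    have hne : ((volume : Measure I).restrict (Ioi ⟨_, hmem⟩)) ≠ 0 := by
      rwa [Ne, Measure.restrict_eq_zero]
    have : (ae ((volume : Measure I).restrict (Ioi ⟨_, hmem⟩))).NeBot := ae_neBot.2 hne
    obtain ⟨x, hx1, hx2⟩ := ((ae_restrict_of_ae (s := Ioi ⟨_, hmem⟩) h1).and
      (ae_restrict_mem measurableSet_Ioi)).exists
    exact ⟨x, hx1, hx2⟩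
  choose x hx1 hx2 using h2
  refine AEEqFun.ext (EventuallyEq.trans ?_ AEEqFun.coeFn_zero.symm)
  have h3 : ∀ᵐ t ∂(volume.restrict (⋃ n, Iic (x n))), f t = 0 :=
    ae_restrict_iUnion_iff _ _ |>.2 hx1
  have h4 : ∀ᵐ t : I, t ≠ 1 := by
    rw [ae_iff]; simp
  rw [ae_restrict_iff' (MeasurableSet.iUnion fun n => measurableSet_Iic)] at h3
  filter_upwards [h3, h4] with t ht1 ht2
  refine ht1 (mem_iUnion.2 ?_)
  have ht3 : 0 < 1 - (t : ℝ) := by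
    have : (t : ℝ) ≠ 1 := fun h => ht2 (Subtype.ext h)
    have := lt_of_le_of_ne t.2.2 this
    linarith
  obtain ⟨n, hn⟩ := exists_nat_one_div_lt ht3
  refine ⟨n, ?_⟩
  have := hx2 n
  show (t : ℝ) ≤ x n
  linarith

/-- The Cesàro space `[C, X]` of all `f` with `C |f| ∈ X`, with the norm `‖C |f|‖_X`. -/
def cesaroSpace (X : NormedFunctionSpace (volume : Measure I)) (hX : X.IsBanachFunctionSpace) :
    NormedFunctionSpace (volume : Measure I) where
  carrier :=
    { carrier := {f | CesaroFinite f ∧ cesaro |f| ∈ X.carrier}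
      zero_mem' := by
        refine ⟨?_, ?_⟩
        · refine ae_of_all _ fun x => ?_
          exact (integrable_zero _ _ _).congr
            (ae_restrict_of_ae (AEEqFun.coeFn_zero (β := ℝ)).symm)
        · have := cesaro_abs_smul 0 0
          rw [show |(0 : ℝ)| = 0 from abs_zero, zero_smul, zero_smul] at this
          rw [this]
          exact X.carrier.zero_mem
      add_mem' := fun {f g} hf hg =>
        ⟨hf.1.add hg.1, (hX.ideal _ (X.carrier.add_mem hf.2 hg.2) _
          (cesaro_abs_add_le hf.1 hg.1)).1⟩
      smul_mem' := fun c f hf => by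
        refine ⟨?_, ?_⟩
        · filter_upwards [hf.1] with x hx
          exact (hx.smul c).congr (ae_restrict_of_ae (AEEqFun.coeFn_smul c f).symm)
        · rw [cesaro_abs_smul]
          exact X.carrier.smul_mem _ hf.2 }
  nrm f := X.nrm (cesaro |f|)
  nrm_nonneg f hf := X.nrm_nonneg _ hf.2
  nrm_add_le f hf g hg :=
    ((hX.ideal _ (X.carrier.add_mem hf.2 hg.2) _ (cesaro_abs_add_le hf.1 hg.1)).2).trans
      (X.nrm_add_le _ hf.2 _ hg.2)
  nrm_smul c f hf := by
    rw [cesaro_abs_smul, X.nrm_smul _ _ hf.2, abs_abs]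
  eq_zero_of_nrm_eq_zero f hf h :=
    eq_zero_of_cesaro_abs_eq_zero hf.1 (X.eq_zero_of_nrm_eq_zero _ hf.2 h)

theorem charClass_coe {Ω : Type*} [MeasurableSpace Ω] {μ : Measure Ω} (A : Set Ω)
    (hA : MeasurableSet A) :
    (charClass A hA : Ω →ₘ[μ] ℝ) =ᵐ[μ] A.indicator fun _ => (1 : ℝ) :=
  AEEqFun.coeFn_mk _ _

theorem distributionFun_charClass {Ω : Type*} [MeasurableSpace Ω] {μ : Measure Ω} (A : Set Ω)
    (hA : MeasurableSet A) (τ : ℝ≥0∞) :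
    distributionFun (charClass A hA : Ω →ₘ[μ] ℝ) τ = if τ < 1 then μ A else 0 := by
  have h : distributionFun (charClass A hA : Ω →ₘ[μ] ℝ) τ =
      μ {x | τ < ‖A.indicator (fun _ => (1 : ℝ)) x‖ₑ} := by
    refine measure_congr ?_
    filter_upwards [charClass_coe (μ := μ) A hA] with x hx
    exact congrArg (fun y : ℝ => τ < ‖y‖ₑ) hx
  rw [h]
  split_ifs with hτ
  · congr 1
    ext x
    by_cases hx : x ∈ A <;> simp [hx, hτ]
  · convert measure_empty (μ := μ)
    ext x
    by_cases hx : x ∈ A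
    · simpa [hx] using not_lt.1 hτ
    · simp [hx]

theorem decreasingRearrangement_le {Ω : Type*} [MeasurableSpace Ω] {μ : Measure Ω}
    {f g : Ω →ₘ[μ] ℝ} (h : ∀ τ, distributionFun g τ ≤ distributionFun f τ) (s : ℝ≥0∞) :
    decreasingRearrangement g s ≤ decreasingRearrangement f s :=
  sInf_le_sInf fun τ hτ => (h τ).trans hτ

variable {X : NormedFunctionSpace (volume : Measure I)}

theorem IsRISpace_charClass_le (hX : X.IsRISpace) {A B : Set I} (hA : MeasurableSet A)
    (hB : MeasurableSet B) (hAB : volume A ≤ volume B)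
    (hBX : charClass B hB ∈ X.carrier) :
    charClass A hA ∈ X.carrier ∧ X.nrm (charClass A hA) ≤ X.nrm (charClass B hB) := by
  refine hX.rearrangementInvariant _ hBX _ (decreasingRearrangement_le fun τ => ?_)
  rw [distributionFun_charClass, distributionFun_charClass]
  split_ifs
  · exact hAB
  · exact le_rfl

/-- The level set of a function of `X` is controlled by the function. -/
theorem charClass_level (hX : X.IsRISpace) {f : I →ₘ[volume] ℝ} (hf : f ∈ X.carrier) {c : ℝ}
    (hc : 0 < c) (hB : MeasurableSet {x : I | c < |f x|}) :
    charClass {x : I | c < |f x|} hB ∈ X.carrier ∧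
      c * X.nrm (charClass {x : I | c < |f x|} hB) ≤ X.nrm f := by
  have h := hX.ideal f hf (c • charClass {x : I | c < |f x|} hB) (by
    filter_upwards [AEEqFun.coeFn_smul c (charClass {x : I | c < |f x|} hB),
      charClass_coe (μ := volume) {x : I | c < |f x|} hB] with x h1 h2
    rw [h1, Pi.smul_apply, h2]
    by_cases hx : c < |f x|
    · rw [indicator_of_mem (by exact hx)]
      simpa [abs_of_pos hc] using hx.le
    · rw [indicator_of_notMem (by exact hx)]
      simp)
  have hm : charClass {x : I | c < |f x|} hB ∈ X.carrier := by
    have := X.carrier.smul_mem c⁻¹ h.1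
    rwa [smul_smul, inv_mul_cancel₀ hc.ne', one_smul] at this
  refine ⟨hm, ?_⟩
  have h2 := h.2
  rwa [X.nrm_smul _ _ hm, abs_of_pos hc] at h2

theorem measurableSet_level (f : I →ₘ[volume] ℝ) (c : ℝ) :
    MeasurableSet {x : I | c < |f x|} :=
  measurableSet_lt measurable_const (continuous_abs.measurable.comp f.stronglyMeasurable.measurable)

theorem charClass_univ_mem (hX : X.IsRISpace) : charClass univ MeasurableSet.univ ∈ X.carrier := by
  obtain ⟨f, hf, hf0⟩ := (Submodule.ne_bot_iff _).1 hX.ne_bot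
  obtain ⟨c, hc, hpos⟩ : ∃ c : ℝ, 0 < c ∧ (volume : Measure I) {x : I | c < |f x|} ≠ 0 := by
    by_contra! h
    refine hf0 (AEEqFun.ext (EventuallyEq.trans ?_ AEEqFun.coeFn_zero.symm))
    have : ∀ᵐ x : I, ∀ n : ℕ, ¬ (1 / ((n : ℝ) + 1) < |f x|) := by
      refine ae_all_iff.2 fun n => ?_
      rw [ae_iff]
      simpa only [not_not] using h (1 / ((n : ℝ) + 1)) (by positivity)
    filter_upwards [this] with x hx
    by_contra hne
    obtain ⟨n, hn⟩ := exists_nat_one_div_lt (abs_pos.2 hne)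
    exact hx n hn
  set B := {x : I | c < |f x|} with hBdef
  have hB : MeasurableSet B := measurableSet_level f c
  have hBX := (charClass_level hX hf hc hB).1
  obtain ⟨N, hN⟩ := ENNReal.exists_inv_nat_lt hpos
  have hN0 : N ≠ 0 := by
    rintro rfl
    simp at hN
  let D : ℕ → Set I := fun i => {x : I | (i : ℝ) / N ≤ x ∧ (x : ℝ) ≤ (i + 1) / N}
  have hD : ∀ i, MeasurableSet (D i) := fun i =>
    (measurableSet_le measurable_const measurable_subtype_coe).inter
      (measurableSet_le measurable_subtype_coe measurable_const)
  have hDvol : ∀ i, volume (D i) ≤ volume B := by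
    intro i
    refine le_trans ?_ hN.le
    rw [unitInterval.volume_apply]
    refine (measure_mono (t := Icc ((i : ℝ) / N) ((i + 1) / N)) ?_).trans ?_
    · rintro _ ⟨x, hx, rfl⟩
      exact hx
    · rw [Real.volume_Icc, ← sub_div, add_sub_cancel_left, one_div,
        ENNReal.ofReal_inv_of_pos (by positivity), ENNReal.ofReal_natCast]
  have hDX : ∀ i, charClass (D i) (hD i) ∈ X.carrier := fun i =>
    (IsRISpace_charClass_le hX (hD i) hB (hDvol i) hBX).1
  let U : ℕ → Set I := fun i => {x : I | (x : ℝ) ≤ (i : ℝ) / N}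
  have hU : ∀ i, MeasurableSet (U i) := fun i =>
    measurableSet_le measurable_subtype_coe measurable_const
  have hUX : ∀ i, charClass (U i) (hU i) ∈ X.carrier := by
    intro i
    induction i with
    | zero =>
      refine (IsRISpace_charClass_le hX (hU 0) hB (le_trans ?_ (zero_le)) hBX).1
      refine (measure_mono (t := ({0} : Set I)) ?_).trans (by simp)
      intro x hx
      have : (x : ℝ) ≤ 0 := by simpa [U] using hx
      exact Subtype.ext (le_antisymm this x.2.1)
    | succ i ih =>
      refine (hX.ideal _ (X.carrier.add_mem ih (hDX i)) _ ?_).1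
      filter_upwards [charClass_coe (μ := volume) _ (hU i), charClass_coe (μ := volume) _ (hD i),
        charClass_coe (μ := volume) _ (hU (i + 1)),
        AEEqFun.coeFn_add (charClass (U i) (hU i)) (charClass (D i) (hD i))] with x h1 h2 h3 h4
      rw [h3, h4, Pi.add_apply, h1, h2]
      have hn1 : 0 ≤ (U i).indicator (fun _ => (1 : ℝ)) x :=
        indicator_nonneg (fun _ _ => zero_le_one) _
      have hn2 : 0 ≤ (D i).indicator (fun _ => (1 : ℝ)) x :=
        indicator_nonneg (fun _ _ => zero_le_one) _
      rw [abs_of_nonneg (add_nonneg hn1 hn2)]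
      by_cases hx : x ∈ U (i + 1)
      · rw [indicator_of_mem hx, abs_one]
        by_cases hx' : x ∈ U i
        · rw [indicator_of_mem hx']
          linarith
        · have : x ∈ D i := by
            refine ⟨(not_le.1 hx').le, ?_⟩
            have : (x : ℝ) ≤ ((i + 1 : ℕ) : ℝ) / N := hx
            rwa [Nat.cast_add, Nat.cast_one] at this
          rw [indicator_of_mem this]
          linarith
      · rw [indicator_of_notMem hx, abs_zero]
        exact add_nonneg hn1 hn2
  refine (IsRISpace_charClass_le hX MeasurableSet.univ (hU N) (measure_mono fun x _ => ?_)
    (hUX N)).1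
  show (x : ℝ) ≤ N / N
  rw [div_self (by exact_mod_cast hN0)]
  exact x.2.2

theorem charClass_mem (hX : X.IsRISpace) {A : Set I} (hA : MeasurableSet A) :
    charClass A hA ∈ X.carrier :=
  (IsRISpace_charClass_le hX hA MeasurableSet.univ (measure_mono (subset_univ _))
    (charClass_univ_mem hX)).1

/-- A function bounded by `a` on `A` and by `b` elsewhere belongs to `X`. -/
theorem bounded_mem (hX : X.IsRISpace) {g : I →ₘ[volume] ℝ} {A : Set I} (hA : MeasurableSet A)
    {b : ℝ} (hb : 0 ≤ b) (h : ∀ᵐ x : I, |g x| ≤ A.indicator (fun _ => (1 : ℝ)) x + b) :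
    g ∈ X.carrier ∧ X.nrm g ≤ X.nrm (charClass A hA) +
      b * X.nrm (charClass univ MeasurableSet.univ) := by
  have hA' := charClass_mem hX hA
  have hu := charClass_univ_mem hX
  have h1 := hX.ideal _ (X.carrier.add_mem hA' (X.carrier.smul_mem b hu)) g (by
    filter_upwards [h, charClass_coe (μ := volume) _ hA,
      charClass_coe (μ := (volume : Measure I)) univ MeasurableSet.univ,
      AEEqFun.coeFn_add (charClass A hA : I →ₘ[volume] ℝ) (b • charClass univ MeasurableSet.univ),
      AEEqFun.coeFn_smul b (charClass univ MeasurableSet.univ : I →ₘ[volume] ℝ)]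
      with x e1 e2 e3 e4 e5
    refine e1.trans (le_trans (le_of_eq ?_) (le_abs_self _))
    rw [e4, Pi.add_apply, e2, e5, Pi.smul_apply, e3]
    simp)
  refine ⟨h1.1, h1.2.trans ((X.nrm_add_le _ hA' _ (X.carrier.smul_mem b hu)).trans ?_)⟩
  rw [X.nrm_smul _ _ hu, abs_of_nonneg hb]

/-- In a rearrangement invariant space other than `L∞`, the norms of characteristic functions
of small sets are small. -/
theorem charClass_small (hX : X.IsRISpace)
    (hne : (X.carrier : Set (I →ₘ[volume] ℝ)) ≠ (Lp ℝ ∞ (volume : Measure I) : Set _))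
    {ε : ℝ} (hε : 0 < ε) : ∃ δ : ℝ≥0∞, 0 < δ ∧ ∀ (A : Set I) (hA : MeasurableSet A),
      volume A ≤ δ → X.nrm (charClass A hA) < ε := by
  by_contra! hcon
  refine hne (Set.ext fun f => ⟨fun hf => ?_, fun hf => ?_⟩)
  · show f ∈ Lp ℝ ∞ volume
    rw [Lp.mem_Lp_iff_eLpNorm_lt_top, eLpNorm_exponent_top]
    obtain ⟨n, hn⟩ := exists_nat_gt (X.nrm f / ε)
    have hn0 : 0 < (n : ℝ) := lt_of_le_of_lt (div_nonneg (X.nrm_nonneg _ hf) hε.le) hn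
    by_cases h0 : (volume : Measure I) {x : I | (n : ℝ) < |f x|} = 0
    · refine eLpNormEssSup_lt_top_of_ae_bound (C := n) ?_
      refine (ae_iff.2 ?_ : ∀ᵐ x : I, |f x| ≤ n)
      simpa only [not_le] using h0
    · exfalso
      obtain ⟨A, hA, hAle, hAε⟩ := hcon _ (pos_iff_ne_zero.2 h0)
      have h1 := charClass_level hX hf hn0 (measurableSet_level f n)
      have h2 := (IsRISpace_charClass_le hX hA (measurableSet_level f n) hAle h1.1).2
      rw [div_lt_iff₀ hε] at hn
      nlinarith [h1.2]
  · have hf' : f ∈ Lp ℝ ∞ (volume : Measure I) := hf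
    rw [Lp.mem_Lp_iff_eLpNorm_lt_top, eLpNorm_exponent_top] at hf'
    refine (bounded_mem hX MeasurableSet.empty
      (b := (eLpNormEssSup f volume).toReal) ENNReal.toReal_nonneg ?_).1
    filter_upwards [ae_le_eLpNormEssSup (f := f) (μ := (volume : Measure I))] with x hx
    rw [indicator_empty, zero_add]
    have := ENNReal.toReal_mono hf'.ne hx
    rwa [toReal_enorm, Real.norm_eq_abs] at this

theorem cesaro_charClass_coe {A : Set I} (hA : MeasurableSet A) :
    cesaro (charClass A hA) =ᵐ[volume]
      fun x : I => (x : ℝ)⁻¹ * (volume : Measure I).real (A ∩ Iic x) := by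
  filter_upwards [cesaro_coe (charClass A hA)] with x hx
  rw [hx]
  congr 1
  rw [integral_congr_ae (ae_restrict_of_ae (charClass_coe (μ := volume) A hA)),
    integral_indicator hA, Measure.restrict_restrict hA, setIntegral_const, smul_eq_mul, mul_one]

theorem cesaro_charClass_le {A : Set I} (hA : MeasurableSet A) {t : ℝ} (ht : 0 < t)
    (hAt : volume A ≤ ENNReal.ofReal (t * t)) :
    ∀ᵐ x : I, |cesaro (charClass A hA) x| ≤
      {x : I | (x : ℝ) ≤ t}.indicator (fun _ => (1 : ℝ)) x + t := by
  filter_upwards [cesaro_charClass_coe hA] with x hx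
  rw [hx, abs_of_nonneg (mul_nonneg (inv_nonneg.2 x.2.1) measureReal_nonneg)]
  by_cases hxt : (x : ℝ) ≤ t
  · rw [indicator_of_mem (by exact hxt)]
    have h1 : (volume : Measure I).real (A ∩ Iic x) ≤ x := by
      refine (measureReal_mono inter_subset_right).trans (le_of_eq ?_)
      rw [measureReal_def, unitInterval.volume_Iic, ENNReal.toReal_ofReal x.2.1]
    have h2 : (x : ℝ)⁻¹ * (volume : Measure I).real (A ∩ Iic x) ≤ 1 :=
      (mul_le_mul_of_nonneg_left h1 (inv_nonneg.2 x.2.1)).trans (inv_mul_le_one)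
    linarith
  · rw [indicator_of_notMem (by exact hxt), zero_add]
    have hxt' := not_le.1 hxt
    have h1 : (volume : Measure I).real (A ∩ Iic x) ≤ t * t := by
      refine (measureReal_mono inter_subset_left).trans ?_
      exact ENNReal.toReal_le_of_le_ofReal (by positivity) hAt
    rw [inv_mul_le_iff₀ (ht.trans hxt')]
    nlinarith

theorem cesaro_charClass_mem (hX : X.IsRISpace) {A : Set I} (hA : MeasurableSet A) :
    cesaro (charClass A hA) ∈ X.carrier :=
  (bounded_mem hX (measurableSet_le measurable_subtype_coe measurable_const) zero_le_one (cesaro_charClass_le hA one_pos (by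
    simpa using prob_le_one (μ := (volume : Measure I)) (s := A)))).1

theorem cesaro_charClass_small (hX : X.IsRISpace)
    (hne : (X.carrier : Set (I →ₘ[volume] ℝ)) ≠ (Lp ℝ ∞ (volume : Measure I) : Set _))
    {ε : ℝ} (hε : 0 < ε) : ∃ δ : ℝ≥0∞, 0 < δ ∧ ∀ (A : Set I) (hA : MeasurableSet A),
      volume A ≤ δ → X.nrm (cesaro (charClass A hA)) < ε := by
  obtain ⟨δ, hδ, h⟩ := charClass_small hX hne (half_pos hε)
  set M := X.nrm (charClass univ MeasurableSet.univ)
  have hM : 0 ≤ M := X.nrm_nonneg _ (charClass_univ_mem hX)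
  obtain ⟨s, hs, hsδ⟩ : ∃ s : ℝ, 0 < s ∧ ENNReal.ofReal s ≤ δ := by
    rcases eq_or_ne δ ∞ with rfl | hδ'
    · exact ⟨1, one_pos, le_top⟩
    · exact ⟨δ.toReal, ENNReal.toReal_pos hδ.ne' hδ', ENNReal.ofReal_toReal_le⟩
  set t := min s (ε / (2 * (M + 1)))
  have ht : 0 < t := lt_min hs (by positivity)
  refine ⟨ENNReal.ofReal (t * t), ENNReal.ofReal_pos.2 (by positivity), fun A hA hAt => ?_⟩
  have hmeas : MeasurableSet {x : I | (x : ℝ) ≤ t} :=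
    measurableSet_le measurable_subtype_coe measurable_const
  have h1 := (bounded_mem hX hmeas ht.le (cesaro_charClass_le hA ht hAt)).2
  have h2 := h _ hmeas (by
    refine le_trans ?_ hsδ
    rw [unitInterval.volume_apply]
    refine (measure_mono (t := Icc 0 t) ?_).trans ?_
    · rintro _ ⟨x, hx, rfl⟩
      exact ⟨x.2.1, hx⟩
    · rw [Real.volume_Icc, sub_zero]
      exact ENNReal.ofReal_le_ofReal (min_le_left _ _))
  have h3 : t * M ≤ ε / 2 := by
    have : t ≤ ε / (2 * (M + 1)) := min_le_right _ _
    rw [le_div_iff₀ (by positivity)] at this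
    nlinarith
  linarith

theorem cesaro_charClass_union {A B : Set I} (hA : MeasurableSet A) (hB : MeasurableSet B)
    (hAB : Disjoint A B) :
    cesaro (charClass (A ∪ B) (hA.union hB)) =
      cesaro (charClass A hA) + cesaro (charClass B hB) := by
  refine AEEqFun.ext ?_
  filter_upwards [cesaro_charClass_coe hA, cesaro_charClass_coe hB,
    cesaro_charClass_coe (hA.union hB),
    AEEqFun.coeFn_add (cesaro (charClass A hA)) (cesaro (charClass B hB))] with x h1 h2 h3 h4
  rw [h3, h4, Pi.add_apply, h1, h2, union_inter_distrib_right,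
    measureReal_union (hAB.mono inter_subset_left inter_subset_left)
      (hB.inter measurableSet_Iic), mul_add]

/-- `A ↦ C χ_A` as a set function into `X`. -/
def cesaroSetFun (hX : X.IsRISpace) (A : {A : Set I // MeasurableSet A}) : X.Elem :=
  ⟨cesaro (charClass A.1 A.2), cesaro_charClass_mem hX A.2⟩

theorem cesaroSetFun_norm (hX : X.IsRISpace) (A : {A : Set I // MeasurableSet A}) :
    ‖cesaroSetFun hX A‖ = X.nrm (cesaro (charClass A.1 A.2)) := rfl

theorem cesaroSetFun_union (hX : X.IsRISpace) {A B : Set I} (hA : MeasurableSet A)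
    (hB : MeasurableSet B) (hAB : Disjoint A B) :
    cesaroSetFun hX ⟨A ∪ B, hA.union hB⟩ = cesaroSetFun hX ⟨A, hA⟩ + cesaroSetFun hX ⟨B, hB⟩ :=
  Subtype.ext (cesaro_charClass_union hA hB hAB)

theorem cesaroSetFun_empty (hX : X.IsRISpace) :
    cesaroSetFun hX ⟨∅, MeasurableSet.empty⟩ = 0 := by
  have h := cesaroSetFun_union hX MeasurableSet.empty MeasurableSet.empty (disjoint_empty _)
  simpa using h

theorem cesaroSetFun_hasSum (hX : X.IsRISpace)
    (hne : (X.carrier : Set (I →ₘ[volume] ℝ)) ≠ (Lp ℝ ∞ (volume : Measure I) : Set _))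
    {f : ℕ → Set I} (hf : ∀ i, MeasurableSet (f i)) (hd : Pairwise (Function.onFun Disjoint f)) :
    HasSum (fun i => cesaroSetFun hX ⟨f i, hf i⟩)
      (cesaroSetFun hX ⟨⋃ i, f i, MeasurableSet.iUnion hf⟩) := by
  have hfin : ∀ s : Finset ℕ, ∑ i ∈ s, cesaroSetFun hX ⟨f i, hf i⟩ =
      cesaroSetFun hX ⟨⋃ i ∈ s, f i, s.measurableSet_biUnion fun i _ => hf i⟩ := by
    intro s
    induction s using Finset.induction_on with
    | empty =>
      rw [Finset.sum_empty, ← cesaroSetFun_empty hX]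
      congr 2
      simp
    | insert a s ha ih =>
      rw [Finset.sum_insert ha, ih, ← cesaroSetFun_union]
      · simp only [Finset.set_biUnion_insert]
      · refine disjoint_iUnion₂_right.2 fun i hi => hd ?_
        rintro rfl
        exact ha hi
  have hdiff : ∀ s : Finset ℕ, cesaroSetFun hX ⟨⋃ i, f i, MeasurableSet.iUnion hf⟩ -
      ∑ i ∈ s, cesaroSetFun hX ⟨f i, hf i⟩ =
      cesaroSetFun hX ⟨(⋃ i, f i) \ ⋃ i ∈ s, f i,
        (MeasurableSet.iUnion hf).diff (s.measurableSet_biUnion fun i _ => hf i)⟩ := by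
    intro s
    rw [hfin, sub_eq_iff_eq_add, ← cesaroSetFun_union hX _ _ disjoint_sdiff_left]
    congr 2
    exact (sdiff_union_of_subset (iUnion₂_subset fun i _ => subset_iUnion f i)).symm
  rw [HasSum, SummationFilter.unconditional_filter, Metric.tendsto_atTop]
  intro ε hε
  obtain ⟨δ, hδ, h⟩ := cesaro_charClass_small hX hne hε
  have hsum : HasSum (fun i => volume (f i)) (volume (⋃ i, f i)) := by
    rw [measure_iUnion hd hf]; exact ENNReal.summable.hasSum
  have hlim : Tendsto (fun s : Finset ℕ => volume ((⋃ i, f i) \ ⋃ i ∈ s, f i)) atTop (𝓝 0) := by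
    have : ∀ s : Finset ℕ, volume ((⋃ i, f i) \ ⋃ i ∈ s, f i) =
        volume (⋃ i, f i) - ∑ i ∈ s, volume (f i) := by
      intro s
      rw [measure_sdiff (iUnion₂_subset fun i _ => subset_iUnion f i)
        (s.measurableSet_biUnion fun i _ => hf i).nullMeasurableSet (measure_ne_top _ _),
        measure_biUnion_finset (fun i _ j _ hij => hd hij) fun i _ => hf i]
    simp only [this]
    have h2 := ENNReal.Tendsto.sub (tendsto_const_nhds (x := volume (⋃ i, f i))) hsum
      (Or.inl (measure_ne_top _ _))
    rwa [tsub_self] at h2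
  obtain ⟨s, hs⟩ := eventually_atTop.1 (hlim.eventually (gt_mem_nhds hδ))
  refine ⟨s, fun s' hs' => ?_⟩
  rw [dist_comm, dist_eq_norm, hdiff, cesaroSetFun_norm]
  exact h _ _ (hs s' hs').le

open scoped Classical in
/-- The `X`-valued vector measure `m_X : A ↦ C χ_A`. -/
def cesaroMeasure (X : NormedFunctionSpace (volume : Measure I)) (hX : X.IsRISpace)
    (hne : (X.carrier : Set (I →ₘ[volume] ℝ)) ≠ (Lp ℝ ∞ (volume : Measure I) : Set _)) :
    VectorMeasure I X.Elem where
  measureOf' A := if hA : MeasurableSet A then cesaroSetFun hX ⟨A, hA⟩ else 0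
  empty' := by rw [dif_pos MeasurableSet.empty, cesaroSetFun_empty]
  not_measurable' A hA := dif_neg hA
  m_iUnion' f hf hd := by
    simp only [dif_pos (hf _), dif_pos (MeasurableSet.iUnion hf)]
    exact cesaroSetFun_hasSum hX hne hf hd

theorem cesaroMeasure_apply (hX : X.IsRISpace)
    (hne : (X.carrier : Set (I →ₘ[volume] ℝ)) ≠ (Lp ℝ ∞ (volume : Measure I) : Set _))
    {A : Set I} (hA : MeasurableSet A) :
    cesaroMeasure X hX hne A = cesaroSetFun hX ⟨A, hA⟩ :=
  dif_pos hA

/-- `m_X` and Lebesgue measure have the same null sets. -/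
theorem cesaroMeasure_null (hX : X.IsRISpace)
    (hne : (X.carrier : Set (I →ₘ[volume] ℝ)) ≠ (Lp ℝ ∞ (volume : Measure I) : Set _))
    (A : Set I) (hA : MeasurableSet A) :
    IsVectorNull (cesaroMeasure X hX hne) A ↔ volume A = 0 := by
  constructor
  · intro h
    have h1 : cesaroMeasure X hX hne A = 0 := by
      refine SeparatingDual.eq_zero_of_forall_dual_eq_zero (R := ℝ) fun φ => ?_
      rw [← dualMeasure_apply]
      exact (VectorMeasure.variation_apply_eq_zero hA).1 (h φ) A subset_rfl hA
    rw [cesaroMeasure_apply hX hne hA] at h1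
    have h2 : cesaro (charClass A hA) = 0 := congrArg Subtype.val h1
    have h3 : |charClass A hA| = (charClass A hA : I →ₘ[volume] ℝ) := by
      refine AEEqFun.ext ?_
      filter_upwards [AEEqFun.coeFn_abs (charClass A hA : I →ₘ[volume] ℝ),
        charClass_coe (μ := (volume : Measure I)) A hA] with x e1 e2
      rw [e1, e2, abs_of_nonneg (indicator_nonneg (fun _ _ => zero_le_one) _)]
    have h4 : CesaroFinite (charClass A hA) := by
      refine ae_of_all _ fun x => Integrable.integrableOn ?_
      exact ((integrable_const (1 : ℝ)).indicator hA).congr (charClass_coe A hA).symm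
    have h5 := eq_zero_of_cesaro_abs_eq_zero h4 (by rw [h3, h2])
    have h6 : ∀ᵐ x : I, x ∉ A := by
      filter_upwards [charClass_coe (μ := (volume : Measure I)) A hA,
        h5 ▸ AEEqFun.coeFn_zero (β := ℝ)] with x e1 e2 hx
      rw [e2, indicator_of_mem hx] at e1
      simp at e1
    simpa using ae_iff.1 h6
  · intro h φ
    refine (VectorMeasure.variation_apply_eq_zero hA).2 fun B hBA hB => ?_
    rw [dualMeasure_apply, cesaroMeasure_apply hX hne hB]
    have : cesaro (charClass B hB) = 0 := by
      refine AEEqFun.ext (EventuallyEq.trans ?_ AEEqFun.coeFn_zero.symm)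
      filter_upwards [cesaro_charClass_coe hB] with x hx
      rw [hx, measureReal_def, measure_mono_null (inter_subset_left.trans hBA) h]
      simp
    have h0 : cesaroSetFun hX ⟨B, hB⟩ = 0 := Subtype.ext this
    rw [h0, map_zero]

/-- The space `L¹(m_X)`. -/
def cesaroL1 (X : NormedFunctionSpace (volume : Measure I)) (hX : X.IsRISpace)
    (hne : (X.carrier : Set (I →ₘ[volume] ℝ)) ≠ (Lp ℝ ∞ (volume : Measure I) : Set _)) :
    NormedFunctionSpace (volume : Measure I) :=
  vectorL1 (cesaroMeasure X hX hne) volume (cesaroMeasure_null hX hne)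

end Cesaro

end

/-!
Write `Z = [C, X]` and let `Z_a` be its absolutely continuous part.

*Reflexivity.* A function that vanishes on `[0, 1/2)` has bounded averages, so its norm in `Z` is at
most a multiple of its `L¹` norm; and since `C |f| ≥ ∫_{[0, 3/4]} |f|` on `[3/4, 1]`, the norm of `Z`
dominates the `L¹` norm over `[0, 3/4]`. Hence both spaces look like `L¹` between `1/2` and `3/4`.
The normalized characteristic functions of intervals `S n` that shrink to `1/2` are bounded, and a
weak-star cluster point of them in the bidual takes the value `1` at each functional `f ↦ ∫_{S m} f`.
No vector does that, by dominated convergence (`not_isReflexive_of_subspace`).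

*Rearrangements.* An integrable function that vanishes near `0` belongs to `Z_a`. Its reflection in
`1/2` is equimeasurable, but may be concentrated near `0`. Averaging a step function over its cyclic
shifts gives a constant function, so in a rearrangement invariant space the norm of a step function
dominates its mean. As `C (χ_{[0, 1/N]} N)` is `1 / x` on `[1/N, 1]`, its norm grows at least
like the `N`-th harmonic number, and a weighted sum of such functions is integrable but outside
`Z`. So no space between `Z_a` and `Z` is closed under rearrangements (`not_isRearrangementInvariant_of_between`).

*The space `L¹(m_X)`.* For a functional `φ` on `X`, a Hahn decomposition of `φ m_X` gives
`∫ |f| d|φ m_X| ≤ ‖φ‖ ‖f‖_Z` (`lintegral_variation_le`). Simple functions are dense in `Z_a`, whence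
`∫_A f dm_X = C (f χ_A)` for all `f ∈ Z_a` (`apply_cesaroCLM`); a functional that norms `C |f|` shows
that the two norms agree. Conversely, let `f` be integrable and nonnegative. The vectors
`C (f χ_{f ≤ n})` increase and converge weakly to `∫ f dm_X`; in a Banach lattice such a sequence
converges in norm (`tendsto_of_monotone_of_weak`), so `f` is a limit of bounded functions in `Z`, and
bounded functions are in `Z_a`.
-/

open MeasureTheory Set Filter
open scoped ENNReal NNReal Topology

noncomputable section

/-! ### The Cesàro space and its comparison with `L¹` -/

section CesaroBasics

open unitInterval

theorem CesaroFinite.mono {f g : I →ₘ[volume] ℝ} (hf : CesaroFinite f)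
    (h : ∀ᵐ x : I, |g x| ≤ |f x|) : CesaroFinite g := by
  filter_upwards [hf] with x hx
  exact Integrable.mono hx g.aestronglyMeasurable.restrict (ae_restrict_of_ae h)

theorem cesaroFinite_of_integrable {f : I →ₘ[volume] ℝ} (hf : Integrable f) : CesaroFinite f :=
  ae_of_all _ fun _ => hf.integrableOn

theorem cesaro_abs_mono {f g : I →ₘ[volume] ℝ} (hf : CesaroFinite f)
    (h : ∀ᵐ x : I, |g x| ≤ |f x|) : ∀ᵐ x : I, cesaro |g| x ≤ cesaro |f| x := by
  filter_upwards [hf, cesaro_abs_coe f, cesaro_abs_coe g] with x hx e1 e2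
  rw [e1, e2]
  refine mul_le_mul_of_nonneg_left ?_ (inv_nonneg.2 x.2.1)
  exact integral_mono_of_nonneg (ae_of_all _ fun t => abs_nonneg _) hx.abs (ae_restrict_of_ae h)

theorem cesaro_add {f g : I →ₘ[volume] ℝ} (hf : CesaroFinite f) (hg : CesaroFinite g) :
    cesaro (f + g) = cesaro f + cesaro g := by
  refine AEEqFun.ext ?_
  filter_upwards [hf, hg, cesaro_coe f, cesaro_coe g, cesaro_coe (f + g),
    AEEqFun.coeFn_add (cesaro f) (cesaro g)] with x h1 h2 e1 e2 e3 e4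
  rw [e3, e4, Pi.add_apply, e1, e2, ← mul_add, ← integral_add h1 h2]
  congr 1
  exact integral_congr_ae (ae_restrict_of_ae (AEEqFun.coeFn_add f g))

theorem cesaro_smul (c : ℝ) (f : I →ₘ[volume] ℝ) : cesaro (c • f) = c • cesaro f := by
  refine AEEqFun.ext ?_
  filter_upwards [cesaro_coe f, cesaro_coe (c • f), AEEqFun.coeFn_smul c (cesaro f)]
    with x e1 e2 e3
  rw [e2, e3, Pi.smul_apply, e1, smul_eq_mul, mul_left_comm, ← integral_const_mul c]
  congr 1
  exact integral_congr_ae (ae_restrict_of_ae (AEEqFun.coeFn_smul c f))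

theorem abs_cesaro_le (f : I →ₘ[volume] ℝ) : ∀ᵐ x : I, |cesaro f x| ≤ |cesaro |f| x| := by
  filter_upwards [cesaro_coe f, cesaro_abs_coe f, cesaro_abs_nonneg f] with x e1 e2 h
  rw [abs_of_nonneg h, e1, e2, abs_mul, abs_of_nonneg (inv_nonneg.2 x.2.1)]
  exact mul_le_mul_of_nonneg_left abs_integral_le_integral_abs (inv_nonneg.2 x.2.1)

theorem coeFn_mul_charClass (f : I →ₘ[volume] ℝ) {A : Set I} (hA : MeasurableSet A) :
    ∀ᵐ x : I, (f * charClass A hA : I →ₘ[volume] ℝ) x = A.indicator f x := by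
  filter_upwards [AEEqFun.coeFn_mul f (charClass A hA), charClass_coe (μ := volume) A hA]
    with x e1 e2
  rw [e1, Pi.mul_apply, e2]
  by_cases hx : x ∈ A <;> simp [hx]

theorem abs_indicator_le_abs (f : I → ℝ) (A : Set I) (x : I) : |A.indicator f x| ≤ |f x| := by
  by_cases hx : x ∈ A <;> simp [hx]

theorem abs_mul_charClass_le (f : I →ₘ[volume] ℝ) {A : Set I} (hA : MeasurableSet A) :
    ∀ᵐ x : I, |(f * charClass A hA : I →ₘ[volume] ℝ) x| ≤ |f x| := by
  filter_upwards [coeFn_mul_charClass f hA] with x e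
  rw [e]
  exact abs_indicator_le_abs _ _ _

variable {X : NormedFunctionSpace (volume : Measure I)}

/-- The Cesàro space inherits the ideal property. -/
theorem cesaroSpace_ideal (hX : X.IsBanachFunctionSpace) {f g : I →ₘ[volume] ℝ}
    (hf : f ∈ (cesaroSpace X hX).carrier) (h : ∀ᵐ x : I, |g x| ≤ |f x|) :
    g ∈ (cesaroSpace X hX).carrier ∧ (cesaroSpace X hX).nrm g ≤ (cesaroSpace X hX).nrm f := by
  have hle := hX.ideal _ hf.2 (cesaro |g|) (by
    filter_upwards [cesaro_abs_mono hf.1 h, cesaro_abs_nonneg g] with x h1 h2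
    rw [abs_of_nonneg h2]
    exact h1.trans (le_abs_self _))
  exact ⟨⟨hf.1.mono h, hle.1⟩, hle.2⟩

theorem cesaroSpace_mul_charClass (hX : X.IsBanachFunctionSpace) {f : I →ₘ[volume] ℝ}
    (hf : f ∈ (cesaroSpace X hX).carrier) {A : Set I} (hA : MeasurableSet A) :
    f * charClass A hA ∈ (cesaroSpace X hX).carrier ∧
      (cesaroSpace X hX).nrm (f * charClass A hA) ≤ (cesaroSpace X hX).nrm f :=
  cesaroSpace_ideal hX hf (abs_mul_charClass_le f hA)

theorem cesaro_mem (hX : X.IsBanachFunctionSpace) {f : I →ₘ[volume] ℝ}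
    (hf : f ∈ (cesaroSpace X hX).carrier) :
    cesaro f ∈ X.carrier ∧ X.nrm (cesaro f) ≤ (cesaroSpace X hX).nrm f :=
  hX.ideal _ hf.2 _ (abs_cesaro_le f)

/-- The Cesàro operator as a bounded operator from `[C, X]` to `X`. -/
def cesaroCLM (X : NormedFunctionSpace (volume : Measure I)) (hX : X.IsBanachFunctionSpace) :
    (cesaroSpace X hX).Elem →L[ℝ] X.Elem :=
  LinearMap.mkContinuous
    { toFun := fun f => (⟨cesaro f.1, (cesaro_mem hX f.2).1⟩ : X.carrier)
      map_add' := fun f g => Subtype.ext (cesaro_add f.2.1 g.2.1)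
      map_smul' := fun c f => Subtype.ext (cesaro_smul c f.1) } 1
    fun f => by rw [one_mul]; exact (cesaro_mem hX f.2).2

theorem cesaroCLM_coe (hX : X.IsBanachFunctionSpace) (f : (cesaroSpace X hX).Elem) :
    Subtype.val (cesaroCLM X hX f) = cesaro f.1 := rfl

theorem norm_cesaroCLM_le (hX : X.IsBanachFunctionSpace) (f : (cesaroSpace X hX).Elem) :
    ‖cesaroCLM X hX f‖ ≤ ‖f‖ :=
  (cesaro_mem hX f.2).2

theorem abs_charClass {A : Set I} (hA : MeasurableSet A) :
    |(charClass A hA : I →ₘ[volume] ℝ)| = charClass A hA := by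
  refine AEEqFun.ext ?_
  filter_upwards [AEEqFun.coeFn_abs (charClass A hA : I →ₘ[volume] ℝ),
    charClass_coe (μ := (volume : Measure I)) A hA] with x e1 e2
  rw [e1, e2, abs_of_nonneg (indicator_nonneg (fun _ _ => zero_le_one) _)]

theorem integrable_charClass {A : Set I} (hA : MeasurableSet A) :
    Integrable (charClass A hA : I →ₘ[volume] ℝ) :=
  ((integrable_const (1 : ℝ)).indicator hA).congr (charClass_coe A hA).symm

theorem cesaroSpace_charClass_mem (hX : X.IsRISpace) {A : Set I} (hA : MeasurableSet A) :
    charClass A hA ∈ (cesaroSpace X hX.toIsBanachFunctionSpace).carrier :=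
  ⟨cesaroFinite_of_integrable (integrable_charClass hA), by
    rw [abs_charClass]; exact cesaro_charClass_mem hX hA⟩

theorem cesaroSpace_nrm_charClass (hX : X.IsRISpace) {A : Set I} (hA : MeasurableSet A) :
    (cesaroSpace X hX.toIsBanachFunctionSpace).nrm (charClass A hA) =
      X.nrm (cesaro (charClass A hA)) := by
  show X.nrm (cesaro |charClass A hA|) = _
  rw [abs_charClass]

theorem charClass_univ_coe :
    ((charClass univ MeasurableSet.univ : I →ₘ[volume] ℝ) : I → ℝ) =ᵐ[volume] fun _ => 1 := by
  simpa using charClass_coe (μ := (volume : Measure I)) univ MeasurableSet.univ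

/-- Bounded functions lie in the Cesàro space. -/
theorem cesaroSpace_bounded (hX : X.IsRISpace) {f : I →ₘ[volume] ℝ} {c : ℝ}
    (h : ∀ᵐ x : I, |f x| ≤ c) :
    f ∈ (cesaroSpace X hX.toIsBanachFunctionSpace).carrier := by
  refine (cesaroSpace_ideal hX.toIsBanachFunctionSpace
    (Submodule.smul_mem _ c (cesaroSpace_charClass_mem hX MeasurableSet.univ)) ?_).1
  filter_upwards [h, AEEqFun.coeFn_smul c (charClass univ MeasurableSet.univ : I →ₘ[volume] ℝ),
    charClass_univ_coe] with x h1 e1 e2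
  rw [e1, Pi.smul_apply, e2, smul_eq_mul, mul_one]
  exact h1.trans (le_abs_self _)

/-- Integrable functions that vanish near `0` lie in the Cesàro space, because their averages
are bounded. -/
theorem cesaroSpace_of_integrable (hX : X.IsRISpace) {f : I →ₘ[volume] ℝ} (hf : Integrable f)
    (h0 : ∀ᵐ x : I, (x : ℝ) < 1 / 2 → f x = 0) :
    f ∈ (cesaroSpace X hX.toIsBanachFunctionSpace).carrier ∧
      (cesaroSpace X hX.toIsBanachFunctionSpace).nrm f ≤
        2 * (∫ x, |f x|) * X.nrm (charClass univ MeasurableSet.univ) := by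
  have hnn : 0 ≤ 2 * ∫ x, |f x| := mul_nonneg zero_le_two (integral_nonneg fun _ => abs_nonneg _)
  have hu := charClass_univ_mem hX
  have hle := hX.ideal _ (X.carrier.smul_mem (2 * ∫ x, |f x|) hu) (cesaro |f|) (by
    filter_upwards [cesaro_abs_coe f, cesaro_abs_nonneg f, AEEqFun.coeFn_smul (2 * ∫ x, |f x|)
      (charClass univ MeasurableSet.univ : I →ₘ[volume] ℝ), charClass_univ_coe] with x e1 e2 e3 e4
    rw [abs_of_nonneg e2, e3, Pi.smul_apply, e4, smul_eq_mul, mul_one, abs_of_nonneg hnn, e1]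
    rcases lt_or_ge (x : ℝ) (1 / 2) with hx | hx
    · have : ∫ t in Iic x, |f t| = 0 := by
        refine integral_eq_zero_of_ae ?_
        rw [EventuallyEq, ae_restrict_iff' measurableSet_Iic]
        filter_upwards [h0] with t ht htx
        rw [ht (lt_of_le_of_lt (Subtype.coe_le_coe.2 htx) hx), abs_zero, Pi.zero_apply]
      rw [this, mul_zero]
      exact hnn
    · have h1 : (x : ℝ)⁻¹ ≤ 2 := by
        rw [inv_le_comm₀ (by linarith) two_pos]
        linarith
      exact mul_le_mul h1 (setIntegral_le_integral hf.abs (ae_of_all _ fun t => abs_nonneg _))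
        (integral_nonneg fun _ => abs_nonneg _) zero_le_two)
  refine ⟨⟨cesaroFinite_of_integrable hf, hle.1⟩, hle.2.trans (le_of_eq ?_)⟩
  rw [X.nrm_smul _ _ hu, abs_of_nonneg hnn]

theorem nrm_charClass_pos (hX : X.IsRISpace) {A : Set I} (hA : MeasurableSet A)
    (h : volume A ≠ 0) : 0 < X.nrm (charClass A hA) := by
  refine lt_of_le_of_ne (X.nrm_nonneg _ (charClass_mem hX hA)) fun h0 => h ?_
  have h1 := X.eq_zero_of_nrm_eq_zero _ (charClass_mem hX hA) h0.symm
  have h6 : ∀ᵐ x : I, x ∉ A := by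
    filter_upwards [charClass_coe (μ := (volume : Measure I)) A hA,
      h1 ▸ AEEqFun.coeFn_zero (β := ℝ)] with x e1 e2 hx
    rw [e2, indicator_of_mem hx] at e1
    simp at e1
  simpa using ae_iff.1 h6

theorem nrm_charClass_univ_pos (hX : X.IsRISpace) :
    0 < X.nrm (charClass univ MeasurableSet.univ) :=
  nrm_charClass_pos hX _ (by simp)

/-- The last quarter of the unit interval. -/
def lastQuarter : Set I := {x : I | 3 / 4 ≤ (x : ℝ)}

theorem measurableSet_lastQuarter : MeasurableSet lastQuarter :=
  measurableSet_le measurable_const measurable_subtype_coe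

theorem volume_lastQuarter_ne_zero : volume lastQuarter ≠ 0 := by
  have : lastQuarter = Ici (⟨3 / 4, by norm_num, by norm_num⟩ : I) := rfl
  rw [this, unitInterval.volume_Ici]
  norm_num

/-- On `[0, 3/4]` the norm of the Cesàro space dominates the norm of `L¹`. -/
theorem integral_le_cesaroSpace_nrm (hX : X.IsRISpace) {f : I →ₘ[volume] ℝ}
    (hf : f ∈ (cesaroSpace X hX.toIsBanachFunctionSpace).carrier) {S : Set I}
    (hS : ∀ x ∈ S, (x : ℝ) ≤ 3 / 4) :
    IntegrableOn f S ∧ (∫ x in S, |f x|) * X.nrm (charClass lastQuarter measurableSet_lastQuarter) ≤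
      (cesaroSpace X hX.toIsBanachFunctionSpace).nrm f := by
  have hSx : ∀ x ∈ lastQuarter, S ⊆ Iic x := fun x hx y hy =>
    Subtype.coe_le_coe.1 ((hS y hy).trans hx)
  have hint : IntegrableOn f S := by
    have hne : (volume : Measure I).restrict lastQuarter ≠ 0 := by
      rw [Ne, Measure.restrict_eq_zero]
      exact volume_lastQuarter_ne_zero
    have : (ae ((volume : Measure I).restrict lastQuarter)).NeBot := ae_neBot.2 hne
    obtain ⟨x, hx1, hx2⟩ := ((ae_restrict_of_ae (s := lastQuarter) hf.1).and
      (ae_restrict_mem measurableSet_lastQuarter)).exists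
    exact hx1.mono_set (hSx x hx2)
  refine ⟨hint, ?_⟩
  have hc := charClass_mem hX measurableSet_lastQuarter
  have hnn : 0 ≤ ∫ x in S, |f x| := integral_nonneg fun _ => abs_nonneg _
  have h := hX.ideal _ hf.2
    ((∫ x in S, |f x|) • charClass lastQuarter measurableSet_lastQuarter) (by
      filter_upwards [hf.1, cesaro_abs_coe f, cesaro_abs_nonneg f,
        AEEqFun.coeFn_smul (∫ x in S, |f x|)
          (charClass lastQuarter measurableSet_lastQuarter : I →ₘ[volume] ℝ),
        charClass_coe (μ := (volume : Measure I)) _ measurableSet_lastQuarter] with x e0 e1 e2 e3 e4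
      rw [e3, Pi.smul_apply, e4]
      by_cases hx : x ∈ lastQuarter
      · rw [indicator_of_mem hx, smul_eq_mul, mul_one, abs_of_nonneg hnn, abs_of_nonneg e2, e1]
        have hx0 : (0 : ℝ) < x := lt_of_lt_of_le (by norm_num) (show (3 / 4 : ℝ) ≤ x from hx)
        have h1 : 1 ≤ (x : ℝ)⁻¹ := (one_le_inv₀ hx0).2 x.2.2
        have h2 : ∫ x in S, |f x| ≤ ∫ t in Iic x, |f t| :=
          setIntegral_mono_set e0.abs (ae_of_all _ fun _ => abs_nonneg _)
            (hSx x hx).eventuallyLE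
        nlinarith
      · simp [indicator_of_notMem hx])
  have h2 := h.2
  rwa [X.nrm_smul _ _ hc, abs_of_nonneg hnn] at h2

end CesaroBasics

/-! ### Failure of reflexivity -/

section Reflexivity

/-- A weak-star cluster point of `e` in the bidual takes the value `1` at every `ψ m`, whereas
every vector of `E` is annihilated by the `ψ m` in the limit. -/
theorem not_isReflexive_of_functionals {E : Type*} [NormedAddCommGroup E] [NormedSpace ℝ E]
    (e : ℕ → E) (ψ : ℕ → StrongDual ℝ E) {K : ℝ} (he : ∀ n, ‖e n‖ ≤ K)
    (h1 : ∀ m n, m ≤ n → ψ m (e n) = 1) (h0 : ∀ f, Tendsto (fun m => ψ m f) atTop (𝓝 0)) :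
    ¬ IsReflexive E := by
  intro hE
  set U : Ultrafilter ℕ := hyperfilter ℕ
  let J : ℕ → WeakDual ℝ (StrongDual ℝ E) := fun n =>
    StrongDual.toWeakDual (NormedSpace.inclusionInDoubleDual ℝ E (e n))
  have hmem : ∀ n, J n ∈ WeakDual.toStrongDual ⁻¹'
      Metric.closedBall (0 : StrongDual ℝ (StrongDual ℝ E)) K := by
    intro n
    have h : NormedSpace.inclusionInDoubleDual ℝ E (e n) ∈
        Metric.closedBall (0 : StrongDual ℝ (StrongDual ℝ E)) K :=
      (mem_closedBall_zero_iff (E := StrongDual ℝ (StrongDual ℝ E))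
        (a := NormedSpace.inclusionInDoubleDual ℝ E (e n))).2
        ((NormedSpace.double_dual_bound ℝ E (e n)).trans (he n))
    exact h
  obtain ⟨F, -, hF⟩ := (WeakDual.isCompact_closedBall (𝕜 := ℝ)
    (0 : StrongDual ℝ (StrongDual ℝ E)) K).ultrafilter_le_nhds (U.map J)
    (le_principal_iff.2 (Filter.mem_map.2 (Eventually.of_forall hmem)))
  have hF' : Tendsto J U (𝓝 F) := hF
  obtain ⟨f, hf⟩ := hE (WeakDual.toStrongDual F)
  have hψ : ∀ m, ψ m f = 1 := by
    intro m
    have h2 : Tendsto (fun n => ψ m (e n)) U (𝓝 (F (ψ m))) :=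
      ((WeakDual.eval_continuous (ψ m)).tendsto F).comp hF'
    have h3 : Tendsto (fun n => ψ m (e n)) U (𝓝 1) := by
      refine tendsto_const_nhds.congr' ?_
      have : ∀ᶠ n in (U : Filter ℕ), m ≤ n := Nat.hyperfilter_le_atTop (eventually_ge_atTop m)
      filter_upwards [this] with n hn
      exact (h1 m n hn).symm
    have h4 : F (ψ m) = ψ m f := by
      have := congrArg (fun G : StrongDual ℝ (StrongDual ℝ E) => G (ψ m)) hf
      exact this.symm
    rw [← h4]
    exact tendsto_nhds_unique h2 h3
  have := h0 f
  simp only [hψ] at this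
  exact one_ne_zero (tendsto_nhds_unique tendsto_const_nhds this)

open unitInterval

variable {X : NormedFunctionSpace (volume : Measure I)}

/-- A sequence of intervals shrinking to the point `1/2`. -/
def shrinkingInterval (n : ℕ) : Set I := {x : I | 1 / 2 < (x : ℝ) ∧ (x : ℝ) ≤ 1 / 2 + 1 / (n + 4)}

theorem measurableSet_shrinkingInterval (n : ℕ) : MeasurableSet (shrinkingInterval n) :=
  (measurableSet_lt measurable_const measurable_subtype_coe).inter
    (measurableSet_le measurable_subtype_coe measurable_const)

theorem shrinkingInterval_anti : Antitone shrinkingInterval := by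
  intro m n hmn x hx
  refine ⟨hx.1, hx.2.trans ?_⟩
  have : (m : ℝ) ≤ n := Nat.cast_le.2 hmn
  gcongr

theorem shrinkingInterval_le {n : ℕ} {x : I} (hx : x ∈ shrinkingInterval n) :
    (x : ℝ) ≤ 3 / 4 := by
  refine hx.2.trans ?_
  have : 1 / ((n : ℝ) + 4) ≤ 1 / 4 := by
    gcongr
    linarith [(Nat.cast_nonneg n : (0 : ℝ) ≤ n)]
  linarith

theorem volume_shrinkingInterval (n : ℕ) :
    (volume : Measure I).real (shrinkingInterval n) = 1 / (n + 4) := by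
  have hn : 0 ≤ 1 / ((n : ℝ) + 4) := by positivity
  have hn4 : 1 / ((n : ℝ) + 4) ≤ 1 / 4 := by
    gcongr
    linarith [(Nat.cast_nonneg n : (0 : ℝ) ≤ n)]
  have : shrinkingInterval n = Ioc (⟨1 / 2, by norm_num, by norm_num⟩ : I)
    ⟨1 / 2 + 1 / (n + 4), by positivity, by linarith⟩ := rfl
  rw [this, measureReal_def, unitInterval.volume_Ioc, ENNReal.toReal_ofReal]
  · ring
  · simpa using hn

theorem iInter_shrinkingInterval : ⋂ n, shrinkingInterval n = ∅ := by
  refine eq_empty_of_forall_notMem fun x hx => ?_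
  rw [mem_iInter] at hx
  obtain ⟨n, hn⟩ := exists_nat_one_div_lt (sub_pos.2 (hx 0).1)
  have h1 := (hx n).2
  have h2 : 1 / ((n : ℝ) + 4) ≤ 1 / ((n : ℝ) + 1) := by
    gcongr
    norm_num
  linarith

/-- A space of functions that carries the norm of `[C, X]` and contains the characteristic
functions is not reflexive: between `1/2` and `3/4` its norm is equivalent to that of `L¹`. -/
theorem not_isReflexive_of_subspace (hX : X.IsRISpace)
    (Z : NormedFunctionSpace (volume : Measure I))
    (hZ : ∀ f ∈ Z.carrier, f ∈ (cesaroSpace X hX.toIsBanachFunctionSpace).carrier ∧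
      Z.nrm f = (cesaroSpace X hX.toIsBanachFunctionSpace).nrm f)
    (hchar : ∀ (A : Set I) (hA : MeasurableSet A), charClass A hA ∈ Z.carrier) :
    ¬ IsReflexive Z.Elem := by
  set q := X.nrm (charClass lastQuarter measurableSet_lastQuarter)
  have hq : 0 < q := nrm_charClass_pos hX _ volume_lastQuarter_ne_zero
  have hint : ∀ (m : ℕ) (f : Z.Elem), IntegrableOn f.1 (shrinkingInterval m) := fun m f =>
    (integral_le_cesaroSpace_nrm hX (hZ f.1 f.2).1 fun x hx => shrinkingInterval_le hx).1
  let ψ : ℕ → StrongDual ℝ Z.Elem := fun m => LinearMap.mkContinuous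
    { toFun := fun f => ∫ x in shrinkingInterval m, f.1 x
      map_add' := fun f g => by
        rw [← integral_add (hint m f) (hint m g)]
        exact integral_congr_ae (ae_restrict_of_ae (AEEqFun.coeFn_add f.1 g.1))
      map_smul' := fun c f => by
        rw [RingHom.id_apply, smul_eq_mul, ← integral_const_mul c]
        exact integral_congr_ae (ae_restrict_of_ae (AEEqFun.coeFn_smul c f.1)) } q⁻¹
    fun f => by
      have h1 := (integral_le_cesaroSpace_nrm hX (hZ f.1 f.2).1
        fun x hx => shrinkingInterval_le (n := m) hx).2
      rw [← (hZ f.1 f.2).2] at h1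
      have h2 : ∫ x in shrinkingInterval m, |f.1 x| ≤ q⁻¹ * ‖f‖ := by
        rw [inv_mul_eq_div, le_div_iff₀ hq]
        exact h1
      exact abs_integral_le_integral_abs.trans h2
  have hψ : ∀ m f, ψ m f = ∫ x in shrinkingInterval m, f.1 x := fun m f => rfl
  let χ : ℕ → Z.Elem := fun n =>
    (⟨charClass _ (measurableSet_shrinkingInterval n), hchar _ _⟩ : Z.carrier)
  have hχ : ∀ n, ‖χ n‖ ≤ 2 * (1 / (n + 4)) * X.nrm (charClass univ MeasurableSet.univ) := by
    intro n
    refine (le_of_eq (hZ _ (χ n).2).2).trans ?_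
    refine (cesaroSpace_of_integrable hX (integrable_charClass
      (measurableSet_shrinkingInterval n)) ?_).2.trans (le_of_eq ?_)
    · filter_upwards [charClass_coe (μ := (volume : Measure I)) _
        (measurableSet_shrinkingInterval n)] with x e hx
      rw [e, indicator_of_notMem]
      exact fun h => lt_asymm hx h.1
    · congr 2
      rw [← volume_shrinkingInterval n, ← integral_indicator_one (measurableSet_shrinkingInterval n)]
      refine integral_congr_ae ?_
      filter_upwards [charClass_coe (μ := (volume : Measure I)) _
        (measurableSet_shrinkingInterval n)] with x e
      rw [e, abs_of_nonneg (indicator_nonneg (fun _ _ => zero_le_one) _)]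
      rfl
  refine not_isReflexive_of_functionals (fun n => ((n : ℝ) + 4) • χ n) ψ
    (K := 2 * X.nrm (charClass univ MeasurableSet.univ)) (fun n => ?_) (fun m n hmn => ?_)
    fun f => ?_
  · have hn : (0 : ℝ) < n + 4 := by positivity
    rw [norm_smul, Real.norm_of_nonneg hn.le]
    refine (mul_le_mul_of_nonneg_left (hχ n) hn.le).trans (le_of_eq ?_)
    field_simp
  · have hn : (0 : ℝ) < n + 4 := by positivity
    rw [map_smul, hψ]
    have : ∫ x in shrinkingInterval m, (χ n).1 x = 1 / (n + 4) := by
      rw [integral_congr_ae (ae_restrict_of_ae (charClass_coe (μ := volume) _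
        (measurableSet_shrinkingInterval n))), integral_indicator
        (measurableSet_shrinkingInterval n), Measure.restrict_restrict
        (measurableSet_shrinkingInterval n), inter_eq_left.2 (shrinkingInterval_anti hmn),
        setIntegral_const, volume_shrinkingInterval, smul_eq_mul, mul_one]
    rw [this, smul_eq_mul]
    field_simp
  · simp only [hψ]
    have := tendsto_setIntegral_of_antitone (μ := (volume : Measure I)) (f := f.1)
      measurableSet_shrinkingInterval shrinkingInterval_anti ⟨0, hint 0 f⟩
    rwa [iInter_shrinkingInterval, setIntegral_empty] at this

theorem cesaroSpace_not_isReflexive (hX : X.IsRISpace) :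
    ¬ IsReflexive (cesaroSpace X hX.toIsBanachFunctionSpace).Elem :=
  not_isReflexive_of_subspace hX _ (fun _ hf => ⟨hf, rfl⟩)
    fun _ hA => cesaroSpace_charClass_mem hX hA

end Reflexivity

/-! ### Step functions and their cyclic shifts -/

section CyclicShifts

open unitInterval

/-- The index of the interval `[k/N, (k+1)/N)` that contains `x`; the endpoint `1` gets the
index `0`. -/
def gridIndex (N : ℕ) [NeZero N] (x : I) : Fin N := Fin.ofNat N ⌊(N : ℝ) * x⌋₊

theorem measurable_gridIndex (N : ℕ) [NeZero N] : Measurable (gridIndex N) := by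
  have h : Measurable (fun k : ℕ => Fin.ofNat N k) := measurable_from_top
  exact h.comp (Nat.measurable_floor.comp (measurable_const.mul measurable_subtype_coe))

theorem gridIndex_eq_iff (N : ℕ) [NeZero N] {x : I} (hx : x ≠ 1) (i : Fin N) :
    gridIndex N x = i ↔ (i : ℝ) / N ≤ x ∧ (x : ℝ) < (i + 1) / N := by
  have hN : (0 : ℝ) < N := Nat.cast_pos.2 (NeZero.pos N)
  have hx1 : (x : ℝ) < 1 := lt_of_le_of_ne x.2.2 fun h => hx (Subtype.ext h)
  have hlt : ⌊(N : ℝ) * x⌋₊ < N := by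
    rw [Nat.floor_lt (mul_nonneg hN.le x.2.1)]
    nlinarith
  rw [Fin.ext_iff, gridIndex, Fin.val_ofNat, Nat.mod_eq_of_lt hlt,
    Nat.floor_eq_iff (mul_nonneg hN.le x.2.1), div_le_iff₀ hN, lt_div_iff₀ hN, mul_comm (N : ℝ)]

theorem volume_gridIndex (N : ℕ) [NeZero N] (i : Fin N) :
    (volume : Measure I) (gridIndex N ⁻¹' {i}) = ENNReal.ofReal (1 / N) := by
  have hN : (0 : ℝ) < N := Nat.cast_pos.2 (NeZero.pos N)
  have hi : ((i : ℕ) : ℝ) + 1 ≤ N := by exact_mod_cast i.2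
  have h0 : (0 : ℝ) ≤ (i : ℕ) := Nat.cast_nonneg _
  have h : gridIndex N ⁻¹' {i} =ᵐ[volume]
      Ico (⟨(i : ℝ) / N, by positivity, by rw [div_le_one hN]; linarith⟩ : I)
        ⟨(i + 1) / N, by positivity, by rw [div_le_one hN]; linarith⟩ := by
    have h1 : ∀ᵐ x : I, x ≠ 1 := by
      rw [ae_iff]; simp
    filter_upwards [h1] with x hx
    exact propext (gridIndex_eq_iff N hx i)
  rw [measure_congr h, unitInterval.volume_Ico]
  congr 1
  show ((i : ℕ) + 1 : ℝ) / N - (i : ℕ) / N = _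
  ring

/-- The step function with value `c i` on the `i`-th interval of the grid. -/
def stepClass (N : ℕ) [NeZero N] (c : Fin N → ℝ) : I →ₘ[volume] ℝ :=
  AEEqFun.mk (fun x => c (gridIndex N x))
    ((measurable_from_top.comp (measurable_gridIndex N)).aestronglyMeasurable)

theorem stepClass_coe (N : ℕ) [NeZero N] (c : Fin N → ℝ) :
    stepClass N c =ᵐ[volume] fun x => c (gridIndex N x) :=
  AEEqFun.coeFn_mk _ _

theorem distributionFun_stepClass (N : ℕ) [NeZero N] (c : Fin N → ℝ) (τ : ℝ≥0∞) :
    distributionFun (stepClass N c) τ =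
      (Finset.univ.filter fun i => τ < ‖c i‖ₑ).card * ENNReal.ofReal (1 / N) := by
  have h : distributionFun (stepClass N c) τ =
      volume (gridIndex N ⁻¹' ((Finset.univ.filter fun i => τ < ‖c i‖ₑ : Finset (Fin N)))) := by
    refine measure_congr ?_
    filter_upwards [stepClass_coe N c] with x hx
    have hiff : τ < ‖stepClass N c x‖ₑ ↔
        gridIndex N x ∈ (Finset.univ.filter fun i => τ < ‖c i‖ₑ) := by
      rw [hx]
      simp
    exact propext hiff
  rw [h, ← Measure.map_apply (measurable_gridIndex N) (Finset.measurableSet _),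
    ← sum_measure_singleton]
  simp only [Measure.map_apply (measurable_gridIndex N) (measurableSet_singleton _),
    volume_gridIndex, Finset.sum_const, nsmul_eq_mul]

variable {X : NormedFunctionSpace (volume : Measure I)}

/-- The average of the cyclic shifts of a step function is constant, and the shifts are
equimeasurable; so the norm of the step function dominates its mean. -/
theorem mean_mul_nrm_le_nrm_stepClass (hX : X.IsRISpace) (N : ℕ) [NeZero N] (c : Fin N → ℝ) :
    |∑ i, c i| / N * X.nrm (charClass univ MeasurableSet.univ) ≤ X.nrm (stepClass N c) := by
  have hN : (0 : ℝ) < N := Nat.cast_pos.2 (NeZero.pos N)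
  have hu := charClass_univ_mem hX
  have hmem : ∀ c : Fin N → ℝ, stepClass N c ∈ X.carrier := fun c =>
    (bounded_mem hX MeasurableSet.empty (b := ∑ i, |c i|)
      (Finset.sum_nonneg fun _ _ => abs_nonneg _) (by
        filter_upwards [stepClass_coe N c] with x hx
        rw [hx, indicator_empty, zero_add]
        exact Finset.single_le_sum (f := fun i => |c i|) (fun _ _ => abs_nonneg _)
          (Finset.mem_univ _))).1
  have hshift : ∀ j : Fin N, X.nrm (stepClass N fun i => c (i - j)) ≤ X.nrm (stepClass N c) := by
    intro j
    refine (hX.rearrangementInvariant _ (hmem c) _ (decreasingRearrangement_le fun τ => ?_)).2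
    rw [distributionFun_stepClass, distributionFun_stepClass]
    refine le_of_eq ?_
    congr 2
    exact Finset.card_bij' (fun i _ => i - j) (fun i _ => i + j) (by simp) (by simp) (by simp)
      (by simp)
  have hsum : ∑ j : Fin N, stepClass N (fun i => c (i - j)) =
      (∑ i, c i) • charClass univ MeasurableSet.univ := by
    refine AEEqFun.ext ?_
    have h1 : ∀ᵐ x : I, ∀ j : Fin N, stepClass N (fun i => c (i - j)) x = c (gridIndex N x - j) :=
      ae_all_iff.2 fun j => stepClass_coe N _
    have h2 : ∀ s : Finset (Fin N), ((∑ j ∈ s, stepClass N (fun i => c (i - j)) :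
        I →ₘ[volume] ℝ) : I → ℝ) =ᵐ[volume] fun x => ∑ j ∈ s, stepClass N (fun i => c (i - j)) x := by
      intro s
      induction s using Finset.induction_on with
      | empty => exact AEEqFun.coeFn_zero
      | insert a s ha ih =>
        rw [Finset.sum_insert ha]
        filter_upwards [ih, AEEqFun.coeFn_add (stepClass N (fun i => c (i - a)))
          (∑ j ∈ s, stepClass N (fun i => c (i - j)))] with x e1 e2
        rw [e2, Pi.add_apply, e1, Finset.sum_insert ha]
    filter_upwards [h1, h2 Finset.univ, AEEqFun.coeFn_smul (∑ i, c i)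
      (charClass univ MeasurableSet.univ : I →ₘ[volume] ℝ), charClass_univ_coe] with x e1 e2 e3 e4
    rw [e2, e3, Pi.smul_apply, e4, smul_eq_mul, mul_one]
    simp only [e1]
    exact (Equiv.subLeft (gridIndex N x)).sum_comp c
  have hle : ∀ s : Finset (Fin N), X.nrm (∑ j ∈ s, stepClass N (fun i => c (i - j))) ≤
      s.card * X.nrm (stepClass N c) := by
    intro s
    induction s using Finset.induction_on with
    | empty =>
      have := X.nrm_smul 0 _ X.carrier.zero_mem
      rw [smul_zero, abs_zero, zero_mul] at this
      simp [this]
    | insert a s ha ih =>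
      rw [Finset.sum_insert ha, Finset.card_insert_of_notMem ha]
      refine (X.nrm_add_le _ (hmem _) _ (X.carrier.sum_mem fun j _ => hmem _)).trans ?_
      push_cast
      linarith [hshift a]
  have h := hle Finset.univ
  rw [hsum, X.nrm_smul _ _ hu, Finset.card_univ, Fintype.card_fin] at h
  rw [div_mul_eq_mul_div, div_le_iff₀ hN]
  linarith

end CyclicShifts

/-! ### Failure of rearrangement invariance -/

section NotRearrangementInvariant

open unitInterval

variable {X : NormedFunctionSpace (volume : Measure I)}

/-- The class of the reflected function `x ↦ f (1 - x)`. -/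
def reflect (f : I →ₘ[volume] ℝ) : I →ₘ[volume] ℝ :=
  f.compMeasurePreserving σ measurePreserving_symm

theorem reflect_coe (f : I →ₘ[volume] ℝ) : reflect f =ᵐ[volume] fun x => f (σ x) :=
  AEEqFun.coeFn_compMeasurePreserving f measurePreserving_symm

theorem distributionFun_reflect (f : I →ₘ[volume] ℝ) (τ : ℝ≥0∞) :
    distributionFun (reflect f) τ = distributionFun f τ := by
  have h : distributionFun (reflect f) τ = volume (σ ⁻¹' {x | τ < ‖f x‖ₑ}) := by
    refine measure_congr ?_
    filter_upwards [reflect_coe f] with x hx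
    refine propext ?_
    show τ < ‖reflect f x‖ₑ ↔ τ < ‖f (σ x)‖ₑ
    rw [hx]
  rw [h, measurePreserving_symm.measure_preimage]
  · rfl
  · exact (measurableSet_lt measurable_const
      f.stronglyMeasurable.measurable.enorm).nullMeasurableSet

/-- Integrable functions that vanish near `0` lie in the absolutely continuous part of the
Cesàro space. -/
theorem mem_acPart_of_integrable (hX : X.IsRISpace) {f : I →ₘ[volume] ℝ} (hf : Integrable f)
    (h0 : ∀ᵐ x : I, (x : ℝ) < 1 / 2 → f x = 0) :
    f ∈ (cesaroSpace X hX.toIsBanachFunctionSpace).acPart := by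
  refine ⟨(cesaroSpace_of_integrable hX hf h0).1, fun ε hε => ?_⟩
  set M := X.nrm (charClass univ MeasurableSet.univ)
  have hM : 0 < M := nrm_charClass_univ_pos hX
  have hε' : ENNReal.ofReal (ε / (2 * M)) ≠ 0 := by
    rw [Ne, ENNReal.ofReal_eq_zero, not_le]
    positivity
  obtain ⟨δ, hδ, h⟩ := exists_pos_setLIntegral_lt_of_measure_lt (μ := (volume : Measure I))
    (f := fun x => ‖f x‖ₑ) hf.2.ne hε'
  refine ⟨δ, hδ, fun A hA hAδ => ?_⟩
  have hcoe := coeFn_mul_charClass f hA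
  have hint : Integrable (f * charClass A hA : I →ₘ[volume] ℝ) :=
    (hf.indicator hA).congr (EventuallyEq.symm hcoe)
  refine (cesaroSpace_of_integrable hX hint ?_).2.trans_lt ?_
  · filter_upwards [h0, hcoe] with x e1 e2 hx
    rw [e2]
    by_cases hxA : x ∈ A <;> simp [hxA, e1 hx]
  · have h1 : ∫ x, |(f * charClass A hA : I →ₘ[volume] ℝ) x| = ∫ x in A, |f x| := by
      rw [← integral_indicator hA]
      refine integral_congr_ae ?_
      filter_upwards [hcoe] with x e
      rw [e]
      by_cases hxA : x ∈ A <;> simp [hxA]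
    have h2 : ∫ x in A, |f x| < ε / (2 * M) := by
      have h3 := h A hAδ
      rw [← ofReal_integral_norm_eq_lintegral_enorm hf.integrableOn] at h3
      exact (ENNReal.ofReal_lt_ofReal_iff (by positivity)).1 h3
    rw [h1]
    rw [lt_div_iff₀ (by positivity)] at h2
    linarith

/-- If `|g|` has mass at least `a` on `[0, 1/N]`, then `C |g| ≥ a / x` on `[1/N, 1]`, and the means of
step functions below `C |g|` give a lower bound of logarithmic size for the norm of `g`. -/
theorem harmonic_le_cesaroSpace_nrm (hX : X.IsRISpace) {g : I →ₘ[volume] ℝ}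
    (hg : g ∈ (cesaroSpace X hX.toIsBanachFunctionSpace).carrier) {a : ℝ} (ha : 0 ≤ a) {N : ℕ}
    [NeZero N] (h : ∀ x : I, 1 / (N : ℝ) ≤ x → a ≤ ∫ t in Iic x, |g t|) :
    a * (∑ k ∈ Finset.range N, 1 / ((k : ℝ) + 1) - 1) *
      X.nrm (charClass univ MeasurableSet.univ) ≤
        (cesaroSpace X hX.toIsBanachFunctionSpace).nrm g := by
  have hN : (0 : ℝ) < N := Nat.cast_pos.2 (NeZero.pos N)
  -- The first interval is dropped: there the mass of `g` to the left of `x` is not controlled.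
  let c : Fin N → ℝ := fun i => if (i : ℕ) = 0 then 0 else a * N / ((i : ℕ) + 1)
  have hc : ∀ i, 0 ≤ c i := by
    intro i
    by_cases hi : (i : ℕ) = 0
    · exact le_of_eq (if_pos hi).symm
    · simp only [c, hi, if_false]
      positivity
  have hsum : ∑ i, c i = N * (a * (∑ k ∈ Finset.range N, 1 / ((k : ℝ) + 1) - 1)) := by
    obtain ⟨M, rfl⟩ := Nat.exists_eq_succ_of_ne_zero (NeZero.ne N)
    rw [Finset.sum_range_succ', Fin.sum_univ_succ]
    simp only [c, Fin.val_zero, if_true, Fin.val_succ, Nat.succ_ne_zero, if_false, zero_add,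
      Nat.cast_zero, div_one, add_sub_cancel_right, Finset.mul_sum]
    rw [Fin.sum_univ_eq_sum_range (fun k => a * ((M.succ : ℕ) : ℝ) / (((k + 1 : ℕ) : ℝ) + 1))]
    refine Finset.sum_congr rfl fun k _ => ?_
    ring
  have h1 := mean_mul_nrm_le_nrm_stepClass hX N c
  rw [abs_of_nonneg (Finset.sum_nonneg fun i _ => hc i), hsum, mul_div_cancel_left₀ _ hN.ne'] at h1
  refine h1.trans (hX.ideal _ hg.2 _ ?_).2
  have hx1 : ∀ᵐ x : I, x ≠ 1 := by
    rw [ae_iff]; simp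
  filter_upwards [stepClass_coe N c, cesaro_abs_coe g, cesaro_abs_nonneg g, hx1] with x e1 e2 e3 e4
  rw [e1, abs_of_nonneg (hc _), abs_of_nonneg e3]
  obtain ⟨hl, hr⟩ := (gridIndex_eq_iff N e4 (gridIndex N x)).1 rfl
  by_cases hi : (gridIndex N x : ℕ) = 0
  · simp only [c, hi, if_true]
    exact e3
  · simp only [c, hi, if_false]
    have hi1 : (1 : ℝ) ≤ (gridIndex N x : ℕ) := by exact_mod_cast Nat.one_le_iff_ne_zero.2 hi
    have hxN : 1 / (N : ℝ) ≤ x := le_trans (by gcongr) hl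
    have hx0 : (0 : ℝ) < x := lt_of_lt_of_le (by positivity) hxN
    rw [e2]
    refine le_trans ?_ (mul_le_mul_of_nonneg_left (h x hxN) (inv_nonneg.2 hx0.le))
    rw [lt_div_iff₀ hN] at hr
    rw [inv_mul_eq_div, div_le_div_iff₀ (by positivity) hx0]
    nlinarith

theorem exists_le_harmonic_sub_one (C : ℝ) : ∃ N : ℕ, 2 ≤ N ∧
    C ≤ ∑ k ∈ Finset.range N, 1 / ((k : ℝ) + 1) - 1 := by
  obtain ⟨N, h1, h2⟩ := ((Real.tendsto_sum_range_one_div_nat_succ_atTop.eventually_ge_atTop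
    (C + 1)).and (eventually_ge_atTop 2)).exists
  exact ⟨N, h2, by linarith⟩

/-- There is an integrable function outside the Cesàro space: a sum of normalized characteristic
functions of intervals `[0, 1/N]`, whose weights decay slower than the harmonic sums grow. -/
theorem exists_integrable_notMem_cesaroSpace (hX : X.IsRISpace) :
    ∃ g : I →ₘ[volume] ℝ, Integrable g ∧ (∀ᵐ x : I, 1 / 2 < (x : ℝ) → g x = 0) ∧
      g ∉ (cesaroSpace X hX.toIsBanachFunctionSpace).carrier := by
  choose N hN2 hN using fun j : ℕ => exists_le_harmonic_sub_one ((4 : ℝ) ^ j)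
  have hNpos : ∀ j, (0 : ℝ) < N j := fun j => by
    have := hN2 j
    positivity
  have hN0 : ∀ j, NeZero (N j) := fun j => ⟨by have := hN2 j; omega⟩
  let p : ℕ → I := fun j => ⟨1 / N j, by positivity, by
    rw [div_le_one (hNpos j)]; exact_mod_cast (by have := hN2 j; omega : 1 ≤ N j)⟩
  -- The `j`-th term has mass `2⁻ʲ`, while the harmonic sum that belongs to it is at least `4ʲ`.
  let G : I → ℝ≥0∞ := fun x => ∑' j, (Iic (p j)).indicator (fun _ => (2⁻¹ : ℝ≥0∞) ^ j * N j) x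
  have hGm : Measurable G := 
    Measurable.tsum fun j => measurable_const.indicator measurableSet_Iic
  have hterm : ∀ j, ∫⁻ x, (Iic (p j)).indicator (fun _ => (2⁻¹ : ℝ≥0∞) ^ j * N j) x =
      (2⁻¹ : ℝ≥0∞) ^ j := by
    intro j
    rw [lintegral_indicator measurableSet_Iic, setLIntegral_const, unitInterval.volume_Iic]
    show _ * ENNReal.ofReal (1 / N j) = _
    rw [mul_assoc, one_div, ENNReal.ofReal_inv_of_pos (hNpos j), ENNReal.ofReal_natCast,
      ENNReal.mul_inv_cancel (by simpa using (hN0 j).out) (ENNReal.natCast_ne_top _), mul_one]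
  have hGint : ∫⁻ x, G x ≠ ∞ := by
    rw [lintegral_tsum fun j => (measurable_const.indicator measurableSet_Iic).aemeasurable]
    simp only [hterm]
    rw [ENNReal.tsum_geometric]
    simp
  have hgi : Integrable fun x => (G x).toReal := integrable_toReal_of_lintegral_ne_top
    hGm.aemeasurable hGint
  set g : I →ₘ[volume] ℝ := AEEqFun.mk _ hgi.aestronglyMeasurable
  have hg : g =ᵐ[volume] fun x => (G x).toReal := AEEqFun.coeFn_mk _ _
  refine ⟨g, hgi.congr hg.symm, ?_, fun hmem => ?_⟩
  · filter_upwards [hg] with x e hx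
    rw [e]
    have : G x = 0 := by
      refine ENNReal.tsum_eq_zero.2 fun j => indicator_of_notMem (fun hxj => ?_) _
      have h1 : (x : ℝ) ≤ 1 / N j := hxj
      have h2 : 1 / (N j : ℝ) ≤ 1 / 2 := by
        gcongr
        exact_mod_cast hN2 j
      linarith
    rw [this, ENNReal.toReal_zero]
  · have hmass : ∀ (j : ℕ) (x : I), 1 / (N j : ℝ) ≤ x → (2⁻¹ : ℝ) ^ j ≤ ∫ t in Iic x, |g t| := by
      intro j x hx
      have h1 : ∫ t in Iic x, |g t| = (∫⁻ t in Iic x, G t).toReal := by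
        rw [← integral_toReal hGm.aemeasurable.restrict
          (ae_restrict_of_ae (ae_lt_top hGm hGint))]
        refine integral_congr_ae (ae_restrict_of_ae ?_)
        filter_upwards [hg] with t e
        rw [e, abs_of_nonneg ENNReal.toReal_nonneg]
      have h2 : (2⁻¹ : ℝ≥0∞) ^ j ≤ ∫⁻ t in Iic x, G t := by
        have hpx : Iic (p j) ⊆ Iic x := Iic_subset_Iic.2 hx
        rw [← hterm j, lintegral_indicator measurableSet_Iic]
        refine (lintegral_mono_set hpx).trans' ?_
        refine setLIntegral_mono hGm fun t ht => ?_
        refine le_trans ?_ (ENNReal.le_tsum j)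
        rw [indicator_of_mem ht]
      have h3 : ∫⁻ t in Iic x, G t ≠ ∞ := ne_top_of_le_ne_top hGint (setLIntegral_le_lintegral _ _)
      rw [h1]
      have := ENNReal.toReal_mono h3 h2
      simpa using this
    set M := X.nrm (charClass univ MeasurableSet.univ)
    have hM : 0 < M := nrm_charClass_univ_pos hX
    have hbig : ∀ j : ℕ, (2 : ℝ) ^ j * M ≤
        (cesaroSpace X hX.toIsBanachFunctionSpace).nrm g := by
      intro j
      have := hN0 j
      refine le_trans ?_ (harmonic_le_cesaroSpace_nrm hX hmem (by positivity) (hmass j))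
      refine mul_le_mul_of_nonneg_right ?_ hM.le
      refine le_trans (le_of_eq ?_) (mul_le_mul_of_nonneg_left (hN j) (by positivity))
      rw [← mul_pow]
      norm_num
    obtain ⟨j, hj⟩ := pow_unbounded_of_one_lt
      ((cesaroSpace X hX.toIsBanachFunctionSpace).nrm g / M) one_lt_two
    rw [div_lt_iff₀ hM] at hj
    exact absurd (hbig j) (not_le.2 hj)

/-- A space of functions between `[C, X]_a` and `[C, X]` is not closed under rearrangements: the
reflection moves the singularity of an integrable function from `1`, where it does not matter, to
`0`, where it does. -/
theorem not_isRearrangementInvariant_of_between (hX : X.IsRISpace)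
    (W : NormedFunctionSpace (volume : Measure I))
    (h1 : (cesaroSpace X hX.toIsBanachFunctionSpace).acPart ⊆ W.carrier)
    (h2 : W.carrier ≤ (cesaroSpace X hX.toIsBanachFunctionSpace).carrier) :
    ¬ W.IsRearrangementInvariant := by
  intro hW
  obtain ⟨g, hgi, hg0, hg⟩ := exists_integrable_notMem_cesaroSpace hX
  have hr : Integrable (reflect g) :=
    (measurePreserving_symm.integrable_comp_of_integrable hgi).congr (reflect_coe g).symm
  have hr0 : ∀ᵐ x : I, (x : ℝ) < 1 / 2 → reflect g x = 0 := by
    filter_upwards [reflect_coe g, measurePreserving_symm.quasiMeasurePreserving.ae hg0]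
      with x e1 e2 hx
    rw [e1]
    refine e2 ?_
    rw [coe_symm_eq]
    linarith
  refine hg (h2 (hW _ (h1 (mem_acPart_of_integrable hX hr hr0)) g
    (decreasingRearrangement_le fun τ => ?_)).1)
  rw [distributionFun_reflect]

end NotRearrangementInvariant

/-! ### Integration against the scalar measures `φ m_X` -/

section CesaroMeasureIntegrals

open unitInterval

variable {X : NormedFunctionSpace (volume : Measure I)}

instance isFiniteMeasure_variation {Ω : Type*} [MeasurableSpace Ω] {s : SignedMeasure Ω} :
    IsFiniteMeasure s.variation := by
  rw [← SignedMeasure.totalVariation_eq_variation]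
  infer_instance

theorem variation_real_eq_hahn {Ω : Type*} [MeasurableSpace Ω] (s : SignedMeasure Ω) :
    ∃ P : Set Ω, MeasurableSet P ∧ ∀ A, MeasurableSet A →
      s.variation.real A = s (P ∩ A) - s (Pᶜ ∩ A) := by
  obtain ⟨P, hP, hpos, hneg, h1, h2⟩ := s.toJordanDecomposition_spec
  refine ⟨P, hP, fun A hA => ?_⟩
  rw [← SignedMeasure.totalVariation_eq_variation, SignedMeasure.totalVariation,
    measureReal_add_apply, h1, h2, SignedMeasure.toMeasureOfZeroLE_real_apply _ hpos hP hA,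
    SignedMeasure.toMeasureOfLEZero_real_apply _ hneg hP.compl hA]
  ring

theorem add_mul_charClass (f g : I →ₘ[volume] ℝ) {A : Set I} (hA : MeasurableSet A) :
    (f + g) * charClass A hA = f * charClass A hA + g * charClass A hA := by
  refine AEEqFun.ext ?_
  filter_upwards [coeFn_mul_charClass (f + g) hA, coeFn_mul_charClass f hA,
    coeFn_mul_charClass g hA, AEEqFun.coeFn_add f g,
    AEEqFun.coeFn_add (f * charClass A hA) (g * charClass A hA)] with x e1 e2 e3 e4 e5
  rw [e1, e5, Pi.add_apply, e2, e3]
  by_cases hx : x ∈ A <;> simp [hx, e4]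

theorem smul_mul_charClass (c : ℝ) (f : I →ₘ[volume] ℝ) {A : Set I} (hA : MeasurableSet A) :
    (c • f) * charClass A hA = c • (f * charClass A hA) := by
  refine AEEqFun.ext ?_
  filter_upwards [coeFn_mul_charClass (c • f) hA, coeFn_mul_charClass f hA,
    AEEqFun.coeFn_smul c f, AEEqFun.coeFn_smul c (f * charClass A hA)] with x e1 e2 e3 e4
  rw [e1, e4, Pi.smul_apply, e2]
  by_cases hx : x ∈ A <;> simp [hx, e3]

/-- Multiplication by `χ_A`, as a bounded operator on the Cesàro space. -/
def cesaroRestrict (hX : X.IsBanachFunctionSpace) {A : Set I} (hA : MeasurableSet A) :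
    (cesaroSpace X hX).Elem →L[ℝ] (cesaroSpace X hX).Elem :=
  LinearMap.mkContinuous
    { toFun := fun f => (⟨f.1 * charClass A hA, (cesaroSpace_mul_charClass hX f.2 hA).1⟩ :
        (cesaroSpace X hX).carrier)
      map_add' := fun f g => Subtype.ext (add_mul_charClass f.1 g.1 hA)
      map_smul' := fun c f => Subtype.ext (smul_mul_charClass c f.1 hA) } 1
    fun f => by rw [one_mul]; exact (cesaroSpace_mul_charClass hX f.2 hA).2

theorem norm_cesaroRestrict_le (hX : X.IsBanachFunctionSpace) {A : Set I} (hA : MeasurableSet A)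
    (f : (cesaroSpace X hX).Elem) : ‖cesaroRestrict hX hA f‖ ≤ ‖f‖ :=
  (cesaroSpace_mul_charClass hX f.2 hA).2

/-- The class of a simple function, as an element of the Cesàro space. -/
def cesaroSimple (hX : X.IsRISpace) (s : SimpleFunc I ℝ) :
    (cesaroSpace X hX.toIsBanachFunctionSpace).Elem :=
  (⟨AEEqFun.mk s s.aestronglyMeasurable, by
    obtain ⟨C, hC⟩ := s.exists_forall_norm_le
    refine cesaroSpace_bounded hX (c := C) ?_
    filter_upwards [AEEqFun.coeFn_mk (μ := (volume : Measure I)) s s.aestronglyMeasurable] with x e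
    rw [e]
    exact hC x⟩ : (cesaroSpace X hX.toIsBanachFunctionSpace).carrier)

theorem cesaroSimple_coe (hX : X.IsRISpace) (s : SimpleFunc I ℝ) :
    ((cesaroSimple hX s).1 : I → ℝ) =ᵐ[volume] s :=
  AEEqFun.coeFn_mk _ _

theorem cesaroSimple_add (hX : X.IsRISpace) (s t : SimpleFunc I ℝ) :
    cesaroSimple hX (s + t) = cesaroSimple hX s + cesaroSimple hX t := rfl

theorem cesaroCLM_restrict_simple_const (hX : X.IsRISpace)
    (hne : (X.carrier : Set (I →ₘ[volume] ℝ)) ≠ (Lp ℝ ∞ (volume : Measure I) : Set _))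
    {A B : Set I} (hA : MeasurableSet A) (hB : MeasurableSet B) (c : ℝ) :
    cesaroCLM X _ (cesaroRestrict hX.toIsBanachFunctionSpace hA (cesaroSimple hX
      (SimpleFunc.piecewise B hB (SimpleFunc.const I c) (SimpleFunc.const I 0)))) =
        c • cesaroMeasure X hX hne (A ∩ B) := by
  rw [cesaroMeasure_apply hX hne (hA.inter hB)]
  refine Subtype.ext ?_
  rw [cesaroCLM_coe]
  show cesaro _ = c • cesaro (charClass (A ∩ B) (hA.inter hB))
  rw [← cesaro_smul]
  congr 1
  refine AEEqFun.ext ?_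
  set s := SimpleFunc.piecewise B hB (SimpleFunc.const I c) (SimpleFunc.const I 0) with hs
  filter_upwards [coeFn_mul_charClass (cesaroSimple hX s).1 hA, cesaroSimple_coe hX s,
    AEEqFun.coeFn_smul c (charClass (A ∩ B) (hA.inter hB) : I →ₘ[volume] ℝ),
    charClass_coe (μ := (volume : Measure I)) _ (hA.inter hB)] with x e1 e2 e3 e4
  refine Eq.trans e1 ?_
  rw [e3, Pi.smul_apply, e4]
  by_cases hxA : x ∈ A
  · rw [indicator_of_mem hxA, e2, hs, SimpleFunc.coe_piecewise]
    by_cases hxB : x ∈ B <;> simp [hxA, hxB]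
  · simp [hxA]

/-- The functional `f ↦ ⟨C (f χ_A), φ⟩` is integration over `A` with respect to
`φ m_X`, on simple functions. -/
theorem apply_cesaroCLM_simple (hX : X.IsRISpace)
    (hne : (X.carrier : Set (I →ₘ[volume] ℝ)) ≠ (Lp ℝ ∞ (volume : Measure I) : Set _))
    (φ : StrongDual ℝ X.Elem) {A : Set I} (hA : MeasurableSet A) (s : SimpleFunc I ℝ) :
    φ (cesaroCLM X _ (cesaroRestrict hX.toIsBanachFunctionSpace hA (cesaroSimple hX s))) =
      ∫ᵛ x in A, s x ∂•(dualMeasure (cesaroMeasure X hX hne) φ) := by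
  induction s using SimpleFunc.induction with
  | const c hB =>
    rename_i B
    rw [cesaroCLM_restrict_simple_const hX hne hA hB, map_smul, ← dualMeasure_apply]
    simp only [SimpleFunc.coe_piecewise, SimpleFunc.coe_const, Function.const_zero,
      piecewise_eq_indicator]
    rw [VectorMeasure.integral_indicator hB, VectorMeasure.restrict_restrict _ hB hA, inter_comm B]
    simp only [Function.const_apply]
    rw [VectorMeasure.setIntegral_const]
    simp
  | add hd h1 h2 =>
    rename_i s t
    rw [cesaroSimple_add, map_add, map_add, map_add, h1, h2, ← VectorMeasure.integral_fun_add]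
    · rfl
    · exact VectorMeasure.Integrable.restrict (s.integrable_of_isFiniteMeasure)
    · exact VectorMeasure.Integrable.restrict (t.integrable_of_isFiniteMeasure)

/-- Integration of simple functions against `|φ m_X|` is the functional `f ↦ ⟨C (f ε), φ⟩`, where
`ε = χ_P - χ_{Pᶜ}` for a Hahn decomposition `P`, `Pᶜ`. -/
theorem integral_variation_simple (hX : X.IsRISpace)
    (hne : (X.carrier : Set (I →ₘ[volume] ℝ)) ≠ (Lp ℝ ∞ (volume : Measure I) : Set _))
    (φ : StrongDual ℝ X.Elem) : ∃ (P : Set I) (hP : MeasurableSet P), ∀ s : SimpleFunc I ℝ,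
    ∫ x, s x ∂(dualMeasure (cesaroMeasure X hX hne) φ).variation =
      φ (cesaroCLM X _ (cesaroRestrict hX.toIsBanachFunctionSpace hP (cesaroSimple hX s) -
        cesaroRestrict hX.toIsBanachFunctionSpace hP.compl (cesaroSimple hX s))) := by
  obtain ⟨P, hP, h⟩ := variation_real_eq_hahn (dualMeasure (cesaroMeasure X hX hne) φ)
  refine ⟨P, hP, fun s => ?_⟩
  induction s using SimpleFunc.induction with
  | const c hB =>
    rename_i B
    rw [map_sub, map_sub, cesaroCLM_restrict_simple_const hX hne hP hB,
      cesaroCLM_restrict_simple_const hX hne hP.compl hB, map_smul, map_smul,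
      ← dualMeasure_apply, ← dualMeasure_apply, ← smul_sub, ← h B hB]
    simp only [SimpleFunc.coe_piecewise, SimpleFunc.coe_const, Function.const_zero,
      piecewise_eq_indicator]
    rw [integral_indicator hB]
    simp [mul_comm]
  | add hd h1 h2 =>
    rename_i s t
    rw [cesaroSimple_add, map_add, map_add, add_sub_add_comm, map_add, map_add,
      ← h1, ← h2, ← integral_add s.integrable_of_isFiniteMeasure t.integrable_of_isFiniteMeasure]
    rfl

/-- The norm of `[C, X]` dominates integration against `|φ m_X|`. By a Hahn decomposition,
`∫ s d|φ m_X| = ⟨C (± s), φ⟩` for simple functions `s`. -/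
theorem lintegral_variation_le (hX : X.IsRISpace)
    (hne : (X.carrier : Set (I →ₘ[volume] ℝ)) ≠ (Lp ℝ ∞ (volume : Measure I) : Set _))
    (φ : StrongDual ℝ X.Elem) {f : I →ₘ[volume] ℝ}
    (hf : f ∈ (cesaroSpace X hX.toIsBanachFunctionSpace).carrier) :
    ∫⁻ x, ‖f x‖ₑ ∂(dualMeasure (cesaroMeasure X hX hne) φ).variation ≤
      ENNReal.ofReal (‖φ‖ * (cesaroSpace X hX.toIsBanachFunctionSpace).nrm f) := by
  obtain ⟨P, hP, h⟩ := integral_variation_simple hX hne φ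
  rw [lintegral_eq_nnreal]
  refine iSup₂_le fun s hs => ?_
  set t : SimpleFunc I ℝ := s.map (fun r : ℝ≥0 => (r : ℝ)) with ht
  have h1 : (s.map ((↑) : ℝ≥0 → ℝ≥0∞)).lintegral
      (dualMeasure (cesaroMeasure X hX hne) φ).variation =
      ENNReal.ofReal (∫ x, t x ∂(dualMeasure (cesaroMeasure X hX hne) φ).variation) := by
    rw [ofReal_integral_eq_lintegral_ofReal t.integrable_of_isFiniteMeasure
      (ae_of_all _ fun x => NNReal.coe_nonneg _), ← SimpleFunc.lintegral_eq_lintegral]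
    refine lintegral_congr fun x => ?_
    simp [ht]
  rw [h1, h t]
  refine ENNReal.ofReal_le_ofReal ((le_abs_self _).trans ((φ.le_opNorm _).trans ?_))
  refine mul_le_mul_of_nonneg_left ((norm_cesaroCLM_le _ _).trans ?_) (norm_nonneg _)
  refine (cesaroSpace_ideal hX.toIsBanachFunctionSpace hf ?_).2
  set u := cesaroSimple hX t
  filter_upwards [AEEqFun.coeFn_sub (u.1 * charClass P hP : I →ₘ[volume] ℝ)
    (u.1 * charClass Pᶜ hP.compl), coeFn_mul_charClass u.1 hP, coeFn_mul_charClass u.1 hP.compl,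
    cesaroSimple_coe hX t] with x e1 e2 e3 e4
  have e5 : |u.1 x| ≤ |f x| := by
    have := hs x
    rw [← ENNReal.toReal_le_toReal (by simp) enorm_ne_top] at this
    rw [e4, ht]
    simpa using this
  refine le_trans (le_of_eq ?_) e5
  refine (congrArg abs e1).trans ?_
  rw [Pi.sub_apply, e2, e3]
  by_cases hx : x ∈ P <;> simp [hx]

theorem integrable_variation (hX : X.IsRISpace)
    (hne : (X.carrier : Set (I →ₘ[volume] ℝ)) ≠ (Lp ℝ ∞ (volume : Measure I) : Set _))
    (φ : StrongDual ℝ X.Elem) {f : I →ₘ[volume] ℝ}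
    (hf : f ∈ (cesaroSpace X hX.toIsBanachFunctionSpace).carrier) :
    Integrable f (dualMeasure (cesaroMeasure X hX hne) φ).variation :=
  ⟨f.stronglyMeasurable.aestronglyMeasurable,
    (lintegral_variation_le hX hne φ hf).trans_lt ENNReal.ofReal_lt_top⟩

/-- Simple functions are dense in the absolutely continuous part of the Cesàro space. -/
theorem exists_simple_norm_sub_lt (hX : X.IsRISpace)
    (f : (cesaroSpace X hX.toIsBanachFunctionSpace).Elem)
    (hf : f.1 ∈ (cesaroSpace X hX.toIsBanachFunctionSpace).acPart) {ε : ℝ} (hε : 0 < ε) :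
    ∃ s : SimpleFunc I ℝ, ‖cesaroSimple hX s - f‖ < ε := by
  have hu0 := cesaroSpace_charClass_mem hX MeasurableSet.univ
  obtain ⟨δ, hδ, hac⟩ := hf.2 (ε / 6) (by positivity)
  have hfm : Measurable f.1 := f.1.stronglyMeasurable.measurable
  let s : ℕ → SimpleFunc I ℝ := SimpleFunc.approxOn f.1 hfm univ 0 (mem_univ 0)
  have hs3 : ∀ n x, ‖s n x‖ ≤ ‖f.1 x‖ + ‖f.1 x‖ := fun n x =>
    SimpleFunc.norm_approxOn_zero_le hfm (mem_univ 0) x n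
  have hstend : ∀ x, Tendsto (fun n => s n x) atTop (𝓝 (f.1 x)) := fun x =>
    SimpleFunc.tendsto_approxOn hfm (mem_univ 0) (by simp)
  let Z := cesaroSpace X hX.toIsBanachFunctionSpace
  set u := Z.nrm (charClass univ MeasurableSet.univ)
  have hu : 0 ≤ u := Z.nrm_nonneg _ hu0
  set η : ℝ := ε / (3 * (u + 1))
  have hη : 0 < η := by positivity
  have hηu : η * u ≤ ε / 3 := by
    have : η * (3 * (u + 1)) = ε := div_mul_cancel₀ _ (by positivity)
    nlinarith
  -- Away from a set of small measure the error is at most `η`; on it, at most `3 |f|`.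
  have hlim := tendstoInMeasure_of_tendsto_ae (μ := (volume : Measure I))
    (f := fun n => (s n : I → ℝ)) (g := f.1)
    (fun n => (s n).aestronglyMeasurable) (ae_of_all _ hstend)
    (ENNReal.ofReal η) (by simpa using hη)
  obtain ⟨n, hn⟩ := (hlim.eventually (gt_mem_nhds hδ)).exists
  set A : Set I := {x | ENNReal.ofReal η ≤ edist ((s n : I → ℝ) x) (f.1 x)}
  have hA : MeasurableSet A := measurableSet_le measurable_const ((s n).measurable.edist hfm)
  have h1 := hac A hA hn
  have hfA := (cesaroSpace_mul_charClass hX.toIsBanachFunctionSpace f.2 hA).1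
  set d := cesaroSimple hX (s n) - f
  have hd1 : ∀ᵐ x : I, d.1 x = s n x - f.1 x := by
    filter_upwards [AEEqFun.coeFn_sub (cesaroSimple hX (s n)).1 f.1,
      cesaroSimple_coe hX (s n)] with x e1 e2
    rw [← e2]
    exact e1
  have h2 : ‖cesaroRestrict hX.toIsBanachFunctionSpace hA d‖ ≤
      ‖(3 : ℝ) • cesaroRestrict hX.toIsBanachFunctionSpace hA f‖ := by
    refine (cesaroSpace_ideal hX.toIsBanachFunctionSpace
      ((3 : ℝ) • cesaroRestrict hX.toIsBanachFunctionSpace hA f).2 ?_).2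
    filter_upwards [hd1, coeFn_mul_charClass d.1 hA, coeFn_mul_charClass f.1 hA,
      AEEqFun.coeFn_smul (3 : ℝ) (f.1 * charClass A hA)] with x e1 e2 e3 e4
    refine (le_of_eq (congrArg abs e2)).trans (le_trans ?_ (le_of_eq (congrArg abs e4.symm)))
    rw [Pi.smul_apply, e3]
    by_cases hx : x ∈ A
    · rw [indicator_of_mem hx, indicator_of_mem hx, e1, smul_eq_mul, abs_mul,
        abs_of_pos (three_pos (α := ℝ))]
      have := hs3 n x
      rw [Real.norm_eq_abs, Real.norm_eq_abs] at this
      linarith [abs_sub (s n x) (f.1 x)]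
    · simp [hx]
  have h3 : ‖cesaroRestrict hX.toIsBanachFunctionSpace hA.compl d‖ ≤
      Z.nrm (η • charClass univ MeasurableSet.univ) := by
    refine (cesaroSpace_ideal hX.toIsBanachFunctionSpace (Z.carrier.smul_mem η hu0) ?_).2
    filter_upwards [hd1, coeFn_mul_charClass d.1 hA.compl,
      AEEqFun.coeFn_smul η (charClass univ MeasurableSet.univ : I →ₘ[volume] ℝ),
      charClass_univ_coe] with x e1 e2 e3 e4
    refine (le_of_eq (congrArg abs e2)).trans ?_
    rw [e3, Pi.smul_apply, e4, smul_eq_mul, mul_one, abs_of_pos hη]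
    by_cases hx : x ∈ A
    · simp [hx, hη.le]
    · have hx' : edist (s n x) (f.1 x) < ENNReal.ofReal η := not_le.1 hx
      rw [edist_dist, ENNReal.ofReal_lt_ofReal_iff hη, Real.dist_eq] at hx'
      rw [indicator_of_mem hx, e1]
      exact hx'.le
  have h4 : d = cesaroRestrict hX.toIsBanachFunctionSpace hA d +
      cesaroRestrict hX.toIsBanachFunctionSpace hA.compl d := by
    refine Subtype.ext (AEEqFun.ext ?_)
    filter_upwards [coeFn_mul_charClass d.1 hA, coeFn_mul_charClass d.1 hA.compl,
      AEEqFun.coeFn_add (d.1 * charClass A hA) (d.1 * charClass Aᶜ hA.compl)] with x e1 e2 e3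
    refine Eq.trans ?_ e3.symm
    rw [Pi.add_apply, e1, e2]
    by_cases hx : x ∈ A <;> simp [hx]
  have h5 : ‖d‖ ≤ ‖cesaroRestrict hX.toIsBanachFunctionSpace hA d‖ +
      ‖cesaroRestrict hX.toIsBanachFunctionSpace hA.compl d‖ :=
    (le_of_eq (congrArg _ h4)).trans (norm_add_le _ _)
  rw [Z.nrm_smul _ _ hu0, abs_of_pos hη] at h3
  change _ ≤ η * u at h3
  rw [norm_smul, Real.norm_of_nonneg three_pos.le] at h2
  have h6 : ‖cesaroRestrict hX.toIsBanachFunctionSpace hA f‖ < ε / 6 := h1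
  refine ⟨s n, lt_of_le_of_lt (h5.trans (add_le_add h2 h3)) ?_⟩
  linarith

end CesaroMeasureIntegrals

/-! ### The absolutely continuous part -/

section AbsolutelyContinuousPart

open unitInterval

variable {X : NormedFunctionSpace (volume : Measure I)}

theorem acPart_mono (hX : X.IsBanachFunctionSpace) {f g : I →ₘ[volume] ℝ}
    (hf : f ∈ (cesaroSpace X hX).acPart) (h : ∀ᵐ x : I, |g x| ≤ |f x|) :
    g ∈ (cesaroSpace X hX).acPart := by
  refine ⟨(cesaroSpace_ideal hX hf.1 h).1, fun ε hε => ?_⟩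
  obtain ⟨δ, hδ, hac⟩ := hf.2 ε hε
  refine ⟨δ, hδ, fun A hA hAδ => lt_of_le_of_lt (cesaroSpace_ideal hX
    (cesaroSpace_mul_charClass hX hf.1 hA).1 ?_).2 (hac A hA hAδ)⟩
  filter_upwards [h, coeFn_mul_charClass f hA, coeFn_mul_charClass g hA] with x e1 e2 e3
  rw [e2, e3]
  by_cases hx : x ∈ A <;> simp [hx, e1]

theorem acPart_of_bounded (hX : X.IsRISpace)
    (hne : (X.carrier : Set (I →ₘ[volume] ℝ)) ≠ (Lp ℝ ∞ (volume : Measure I) : Set _))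
    {f : I →ₘ[volume] ℝ} {c : ℝ} (h : ∀ᵐ x : I, |f x| ≤ c) :
    f ∈ (cesaroSpace X hX.toIsBanachFunctionSpace).acPart := by
  refine ⟨cesaroSpace_bounded hX h, fun ε hε => ?_⟩
  have hc : 0 < |c| + 1 := by positivity
  obtain ⟨δ, hδ, hac⟩ := cesaro_charClass_small hX hne (ε := ε / (|c| + 1)) (by positivity)
  refine ⟨δ, hδ, fun A hA hAδ => ?_⟩
  have hmem := cesaroSpace_charClass_mem hX hA
  refine lt_of_le_of_lt (cesaroSpace_ideal hX.toIsBanachFunctionSpace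
    (Submodule.smul_mem _ (|c| + 1) hmem) ?_).2 ?_
  · filter_upwards [h, coeFn_mul_charClass f hA, charClass_coe (μ := (volume : Measure I)) _ hA,
      AEEqFun.coeFn_smul (|c| + 1) (charClass A hA : I →ₘ[volume] ℝ)] with x e1 e2 e3 e4
    rw [e2, e4, Pi.smul_apply, e3]
    by_cases hx : x ∈ A
    · simp only [indicator_of_mem hx, smul_eq_mul, mul_one, abs_of_pos hc]
      linarith [le_abs_self c]
    · simp [hx]
  · rw [NormedFunctionSpace.nrm_smul _ _ _ hmem, cesaroSpace_nrm_charClass hX, abs_of_pos hc]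
    have := hac A hA hAδ.le
    rw [lt_div_iff₀ hc] at this
    linarith

/-- The absolutely continuous part is closed. -/
theorem acPart_of_approx (hX : X.IsBanachFunctionSpace) (f : (cesaroSpace X hX).Elem)
    (h : ∀ ε > 0, ∃ g : (cesaroSpace X hX).Elem, g.1 ∈ (cesaroSpace X hX).acPart ∧
      ‖f - g‖ < ε) : f.1 ∈ (cesaroSpace X hX).acPart := by
  refine ⟨f.2, fun ε hε => ?_⟩
  obtain ⟨g, hg, hfg⟩ := h (ε / 2) (half_pos hε)
  obtain ⟨δ, hδ, hac⟩ := hg.2 (ε / 2) (half_pos hε)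
  refine ⟨δ, hδ, fun A hA hAδ => ?_⟩
  have h1 : ‖cesaroRestrict hX hA f‖ ≤
      ‖cesaroRestrict hX hA (f - g)‖ + ‖cesaroRestrict hX hA g‖ := by
    rw [map_sub]
    exact norm_le_norm_sub_add _ _
  have h2 : ‖cesaroRestrict hX hA g‖ < ε / 2 := hac A hA hAδ
  have h3 := norm_cesaroRestrict_le hX hA (f - g)
  have h4 : ‖cesaroRestrict hX hA f‖ < ε := by linarith
  exact h4

theorem acPart_sub (hX : X.IsBanachFunctionSpace) (f g : (cesaroSpace X hX).Elem)
    (hf : f.1 ∈ (cesaroSpace X hX).acPart) (hg : g.1 ∈ (cesaroSpace X hX).acPart) :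
    (f - g).1 ∈ (cesaroSpace X hX).acPart := by
  refine ⟨(f - g).2, fun ε hε => ?_⟩
  obtain ⟨δ, hδ, hac⟩ := hf.2 (ε / 2) (half_pos hε)
  obtain ⟨δ', hδ', hac'⟩ := hg.2 (ε / 2) (half_pos hε)
  refine ⟨min δ δ', lt_min hδ hδ', fun A hA hAδ => ?_⟩
  have h1 : ‖cesaroRestrict hX hA (f - g)‖ ≤
      ‖cesaroRestrict hX hA f‖ + ‖cesaroRestrict hX hA g‖ := by
    rw [map_sub]
    exact norm_sub_le _ _
  have h2 : ‖cesaroRestrict hX hA f‖ < ε / 2 := hac A hA (hAδ.trans_le (min_le_left _ _))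
  have h3 : ‖cesaroRestrict hX hA g‖ < ε / 2 := hac' A hA (hAδ.trans_le (min_le_right _ _))
  have h4 : ‖cesaroRestrict hX hA (f - g)‖ < ε := by linarith
  exact h4


end AbsolutelyContinuousPart

/-! ### Integrals and norms on the absolutely continuous part -/

section VectorL1

open unitInterval

variable {X : NormedFunctionSpace (volume : Measure I)}

theorem abs_setIntegral_sub_le (hX : X.IsRISpace)
    (hne : (X.carrier : Set (I →ₘ[volume] ℝ)) ≠ (Lp ℝ ∞ (volume : Measure I) : Set _))
    (φ : StrongDual ℝ X.Elem) (A : Set I)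
    (f g : (cesaroSpace X hX.toIsBanachFunctionSpace).Elem) :
    |∫ᵛ x in A, f.1 x ∂•(dualMeasure (cesaroMeasure X hX hne) φ) -
      ∫ᵛ x in A, g.1 x ∂•(dualMeasure (cesaroMeasure X hX hne) φ)| ≤ ‖φ‖ * ‖f - g‖ := by
  rw [← VectorMeasure.integral_fun_sub
    (VectorMeasure.Integrable.restrict (integrable_variation hX hne φ f.2))
    (VectorMeasure.Integrable.restrict (integrable_variation hX hne φ g.2))]
  have h := (VectorMeasure.enorm_setIntegral_le_lintegral_enorm_transpose
    (μ := dualMeasure (cesaroMeasure X hX hne) φ) (B := ContinuousLinearMap.lsmul ℝ ℝ)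
    (f := fun x => f.1 x - g.1 x) (s := A)).trans (setLIntegral_le_lintegral _ _)
  rw [VectorMeasure.variation_transpose_lsmul] at h
  have h2 : ∫⁻ x, ‖f.1 x - g.1 x‖ₑ ∂(dualMeasure (cesaroMeasure X hX hne) φ).variation =
      ∫⁻ x, ‖(f - g).1 x‖ₑ ∂(dualMeasure (cesaroMeasure X hX hne) φ).variation := by
    refine lintegral_congr_ae ((variation_dualMeasure_ac (cesaroMeasure_null hX hne) φ).ae_eq ?_)
    filter_upwards [AEEqFun.coeFn_sub f.1 g.1] with x e
    exact congrArg enorm e.symm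
  rw [h2] at h
  have h3 := h.trans (lintegral_variation_le hX hne φ (f - g).2)
  rw [Real.enorm_eq_ofReal_abs, ENNReal.ofReal_le_ofReal_iff
    (mul_nonneg (norm_nonneg _) (NormedFunctionSpace.nrm_nonneg _ _ (f - g).2))] at h3
  exact h3

/-- On the absolutely continuous part, `⟨C (f χ_A), φ⟩` is the integral of `f` over `A` with
respect to `φ m_X`; that is, `C (f χ_A)` is the integral of `f` over `A` with respect to `m_X`. -/
theorem apply_cesaroCLM (hX : X.IsRISpace)
    (hne : (X.carrier : Set (I →ₘ[volume] ℝ)) ≠ (Lp ℝ ∞ (volume : Measure I) : Set _))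
    (φ : StrongDual ℝ X.Elem) {A : Set I} (hA : MeasurableSet A)
    (f : (cesaroSpace X hX.toIsBanachFunctionSpace).Elem)
    (hf : f.1 ∈ (cesaroSpace X hX.toIsBanachFunctionSpace).acPart) :
    φ (cesaroCLM X _ (cesaroRestrict hX.toIsBanachFunctionSpace hA f)) =
      ∫ᵛ x in A, f.1 x ∂•(dualMeasure (cesaroMeasure X hX hne) φ) := by
  refine eq_of_forall_dist_le fun ε hε => ?_
  obtain ⟨s, hs⟩ := exists_simple_norm_sub_lt hX f hf
    (ε := ε / (2 * ‖φ‖ + 1)) (by positivity)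
  have h1 := apply_cesaroCLM_simple hX hne φ hA s
  have h2 : ∫ᵛ x in A, s x ∂•(dualMeasure (cesaroMeasure X hX hne) φ) =
      ∫ᵛ x in A, (cesaroSimple hX s).1 x ∂•(dualMeasure (cesaroMeasure X hX hne) φ) := by
    refine VectorMeasure.setIntegral_congr_ae (((variation_dualMeasure_ac
      (cesaroMeasure_null hX hne) φ).ae_eq (cesaroSimple_coe hX s)).mono fun x hx _ => hx.symm)
  have h3 := abs_setIntegral_sub_le hX hne φ A (cesaroSimple hX s) f
  have h4 : |φ (cesaroCLM X _ (cesaroRestrict hX.toIsBanachFunctionSpace hA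
      (cesaroSimple hX s - f)))| ≤ ‖φ‖ * ‖cesaroSimple hX s - f‖ :=
    (φ.le_opNorm _).trans (mul_le_mul_of_nonneg_left
      ((norm_cesaroCLM_le _ _).trans (norm_cesaroRestrict_le _ _ _)) (norm_nonneg _))
  rw [map_sub, map_sub, map_sub, h1, h2] at h4
  rw [Real.dist_eq]
  rw [abs_sub_comm] at h4
  refine (abs_sub_le _ _ _).trans ((add_le_add h4 h3).trans ?_)
  rw [lt_div_iff₀ (by positivity)] at hs
  nlinarith [norm_nonneg (cesaroSimple hX s - f)]

/-- The two norms agree on the absolutely continuous part. -/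
theorem vectorENorm_eq (hX : X.IsRISpace)
    (hne : (X.carrier : Set (I →ₘ[volume] ℝ)) ≠ (Lp ℝ ∞ (volume : Measure I) : Set _))
    {f : I →ₘ[volume] ℝ} (hf : f ∈ (cesaroSpace X hX.toIsBanachFunctionSpace).acPart) :
    vectorENorm (cesaroMeasure X hX hne) f =
      ENNReal.ofReal ((cesaroSpace X hX.toIsBanachFunctionSpace).nrm f) := by
  refine le_antisymm (iSup₂_le fun φ hφ => ?_) ?_
  · refine (lintegral_variation_le hX hne φ hf.1).trans (ENNReal.ofReal_le_ofReal ?_)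
    exact mul_le_of_le_one_left (NormedFunctionSpace.nrm_nonneg _ _ hf.1) hφ
  · have habs : |f| ∈ (cesaroSpace X hX.toIsBanachFunctionSpace).acPart := by
      refine acPart_mono hX.toIsBanachFunctionSpace hf ?_
      filter_upwards [AEEqFun.coeFn_abs f] with x e
      rw [e, abs_abs]
    let g : (cesaroSpace X hX.toIsBanachFunctionSpace).Elem :=
      (⟨|f|, habs.1⟩ : (cesaroSpace X hX.toIsBanachFunctionSpace).carrier)
    have hg : cesaroRestrict hX.toIsBanachFunctionSpace MeasurableSet.univ g = g := by
      refine Subtype.ext (AEEqFun.ext ?_)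
      filter_upwards [coeFn_mul_charClass g.1 MeasurableSet.univ] with x e
      refine Eq.trans e ?_
      rw [indicator_univ]
    obtain ⟨φ, hφ, hφg⟩ := exists_dual_vector'' ℝ (cesaroCLM X hX.toIsBanachFunctionSpace g)
    have h1 := apply_cesaroCLM hX hne φ MeasurableSet.univ g habs
    rw [hg, hφg, VectorMeasure.restrict_univ] at h1
    have h2 := VectorMeasure.enorm_integral_le_lintegral_enorm_transpose
      (μ := dualMeasure (cesaroMeasure X hX hne) φ) (B := ContinuousLinearMap.lsmul ℝ ℝ)
      (f := g.1)
    rw [VectorMeasure.variation_transpose_lsmul, ← h1] at h2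
    have h3 : ∫⁻ x, ‖g.1 x‖ₑ ∂(dualMeasure (cesaroMeasure X hX hne) φ).variation =
        ∫⁻ x, ‖f x‖ₑ ∂(dualMeasure (cesaroMeasure X hX hne) φ).variation := by
      refine lintegral_congr_ae ((variation_dualMeasure_ac (cesaroMeasure_null hX hne) φ).ae_eq ?_)
      filter_upwards [AEEqFun.coeFn_abs f] with x e
      have e' : g.1 x = |f x| := e
      rw [e', Real.enorm_abs]
    rw [h3] at h2
    refine le_trans (le_trans (le_of_eq ?_) h2) (le_iSup₂ (f := fun φ
      (_ : φ ∈ {φ : StrongDual ℝ X.Elem | ‖φ‖ ≤ 1}) =>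
        ∫⁻ x, ‖f x‖ₑ ∂(dualMeasure (cesaroMeasure X hX hne) φ).variation) φ hφ)
    rw [Real.enorm_eq_ofReal (by positivity)]
    rfl

/-- A sequence that increases almost everywhere and converges weakly in a Banach function space
converges in norm, and to an upper bound. By Hahn–Banach the limit is in the norm closure of the
convex set of all `y` between `x n` and some `x N`. -/
theorem tendsto_of_monotone_of_weak {Ω : Type*} [MeasurableSpace Ω] {μ : Measure Ω}
    {X : NormedFunctionSpace μ} (hX : X.IsBanachFunctionSpace)
    (x : ℕ → X.Elem) (v : X.Elem) (hmono : ∀ m n, m ≤ n → (x m).1 ≤ᵐ[μ] (x n).1)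
    (hw : ∀ φ : StrongDual ℝ X.Elem, Tendsto (fun n => φ (x n)) atTop (𝓝 (φ v))) :
    (∀ n, (x n).1 ≤ᵐ[μ] v.1) ∧ Tendsto x atTop (𝓝 v) := by
  let K : ℕ → Set X.Elem := fun n => {y | (x n).1 ≤ᵐ[μ] y.1 ∧ ∃ N, y.1 ≤ᵐ[μ] (x N).1}
  have hconv : ∀ n, Convex ℝ (K n) := by
    rintro n y ⟨hy, N, hyN⟩ z ⟨hz, M, hzM⟩ a b ha hb hab
    have hcoe : ((a • y + b • z).1 : Ω → ℝ) =ᵐ[μ] fun t => a * y.1 t + b * z.1 t := by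
      filter_upwards [AEEqFun.coeFn_add (a • y.1) (b • z.1), AEEqFun.coeFn_smul a y.1,
        AEEqFun.coeFn_smul b z.1] with t e1 e2 e3
      refine Eq.trans e1 ?_
      rw [Pi.add_apply, e2, e3]
      rfl
    refine ⟨?_, max N M, ?_⟩
    · filter_upwards [hcoe, hy, hz] with t e1 e2 e3
      rw [e1]
      calc (x n).1 t = a * (x n).1 t + b * (x n).1 t := by rw [← add_mul, hab, one_mul]
        _ ≤ _ := by gcongr
    · filter_upwards [hcoe, hyN.trans (hmono _ _ (le_max_left N M)),
        hzM.trans (hmono _ _ (le_max_right N M))] with t e1 e2 e3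
      rw [e1]
      calc a * y.1 t + b * z.1 t ≤ a * (x (max N M)).1 t + b * (x (max N M)).1 t := by gcongr
        _ = _ := by rw [← add_mul, hab, one_mul]
  have hcl : ∀ n, v ∈ closure (K n) := by
    intro n
    by_contra hv
    obtain ⟨φ, u, hφv, hφ⟩ := geometric_hahn_banach_point_closed (hconv n).closure
      isClosed_closure hv
    refine absurd (ge_of_tendsto (hw φ) ?_) (not_le.2 hφv)
    filter_upwards [eventually_ge_atTop n] with k hk
    exact (hφ _ (subset_closure ⟨hmono n k hk, k, EventuallyLE.rfl⟩)).le
  have happrox : ∀ n, ∀ ε > 0, ∃ y ∈ K n, ‖y - v‖ < ε := by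
    intro n ε hε
    obtain ⟨y, hy, hd⟩ := Metric.mem_closure_iff.1 (hcl n) ε hε
    exact ⟨y, hy, by rwa [← dist_eq_norm, dist_comm]⟩
  have hub : ∀ n, (x n).1 ≤ᵐ[μ] v.1 := by
    intro n
    set w : Ω →ₘ[μ] ℝ := ((x n).1 - v.1) ⊔ 0
    have hwcoe : ∀ᵐ t ∂μ, w t = max ((x n).1 t - v.1 t) 0 := by
      filter_upwards [AEEqFun.coeFn_sup ((x n).1 - v.1) 0, AEEqFun.coeFn_sub (x n).1 v.1,
        AEEqFun.coeFn_zero (μ := μ) (β := ℝ)] with t e1 e2 e3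
      rw [e1, e2, e3]
      rfl
    have hw : ∀ ε > 0, w ∈ X.carrier ∧ X.nrm w < ε := by
      intro ε hε
      obtain ⟨y, hy, hyv⟩ := happrox n ε hε
      have h := hX.ideal _ (y - v).2 w (by
        filter_upwards [hwcoe, hy.1, AEEqFun.coeFn_sub y.1 v.1] with t e1 e2 e3
        have e4 : (y - v).1 t = y.1 t - v.1 t := e3
        rw [e1, e4, abs_of_nonneg (le_max_right _ _)]
        exact max_le ((sub_le_sub_right e2 _).trans (le_abs_self _)) (abs_nonneg _))
      exact ⟨h.1, h.2.trans_lt hyv⟩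
    have hw0 : w = 0 := by
      have hwm := (hw 1 one_pos).1
      exact X.eq_zero_of_nrm_eq_zero _ hwm
        (le_antisymm (le_of_forall_gt fun ε hε => (hw ε hε).2) (X.nrm_nonneg _ hwm))
    filter_upwards [hwcoe, hw0 ▸ AEEqFun.coeFn_zero (μ := μ) (β := ℝ)] with t e1 e2
    rw [e2] at e1
    exact sub_nonpos.1 ((le_max_left _ _).trans_eq e1.symm)
  refine ⟨hub, Metric.tendsto_atTop.2 fun ε hε => ?_⟩
  obtain ⟨y, ⟨-, N, hyN⟩, hyv⟩ := happrox 0 ε hε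
  refine ⟨N, fun n hn => ?_⟩
  rw [dist_eq_norm]
  refine lt_of_le_of_lt (hX.ideal _ (y - v).2 (x n - v).1 ?_).2 hyv
  filter_upwards [hyN, hmono N n hn, hub n, AEEqFun.coeFn_sub (x n).1 v.1,
    AEEqFun.coeFn_sub y.1 v.1] with t e1 e2 e3 e4 e5
  have e6 : (x n - v).1 t = (x n).1 t - v.1 t := e4
  have e7 : (y - v).1 t = y.1 t - v.1 t := e5
  rw [e6, e7, abs_of_nonpos (by linarith), abs_of_nonpos (by linarith)]
  linarith

end VectorL1

/-! ### Identification of `L¹(m_X)` -/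

section VectorL1Eq

open unitInterval

variable {X : NormedFunctionSpace (volume : Measure I)}

/-- If the averages of functions `F n ≥ 0` that converge to `F` are bounded by `v`, so are the
averages of `F`. -/
theorem cesaro_le_of_tendsto {F : I →ₘ[volume] ℝ} {G : ℕ → I →ₘ[volume] ℝ} {v : I →ₘ[volume] ℝ}
    (hG : ∀ n, CesaroFinite (G n)) (hG0 : ∀ n, ∀ᵐ x : I, 0 ≤ G n x) (hF0 : ∀ᵐ x : I, 0 ≤ F x)
    (hlim : ∀ᵐ x : I, Tendsto (fun n => G n x) atTop (𝓝 (F x)))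
    (hv : ∀ n, cesaro (G n) ≤ᵐ[volume] v) :
    CesaroFinite F ∧ cesaro F ≤ᵐ[volume] v := by
  have h0 : ∀ᵐ x : I, x ≠ 0 := by
    rw [ae_iff]; simp
  have key : ∀ᵐ x : I, (x : ℝ) ≠ 0 ∧ 0 ≤ x * v x ∧
      ∫⁻ t in Iic x, ENNReal.ofReal (F t) ≤ ENNReal.ofReal (x * v x) := by
    filter_upwards [ae_all_iff.2 hG, ae_all_iff.2 hv, ae_all_iff.2 fun n => cesaro_coe (G n), h0]
      with x e1 e2 e3 e4
    have hx0 : (x : ℝ) ≠ 0 := fun h => e4 (Subtype.ext h)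
    have hx : (0 : ℝ) < x := lt_of_le_of_ne x.2.1 hx0.symm
    have hle : ∀ n, ∫ t in Iic x, G n t ≤ x * v x := by
      intro n
      have := e2 n
      rwa [e3 n, inv_mul_le_iff₀ hx] at this
    have hnn : 0 ≤ ∫ t in Iic x, G 0 t :=
      integral_nonneg_of_ae (ae_restrict_of_ae (hG0 0))
    refine ⟨hx0, hnn.trans (hle 0), ?_⟩
    have hliminf : ∫⁻ t in Iic x, ENNReal.ofReal (F t) =
        ∫⁻ t in Iic x, liminf (fun n => ENNReal.ofReal (G n t)) atTop := by
      refine lintegral_congr_ae (ae_restrict_of_ae ?_)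
      filter_upwards [hlim] with t ht
      exact ((ENNReal.tendsto_ofReal ht).liminf_eq).symm
    rw [hliminf]
    refine (lintegral_liminf_le fun n =>
      (G n).stronglyMeasurable.measurable.ennreal_ofReal).trans ?_
    refine liminf_le_of_le ⟨0, by simp⟩ fun b hb => ?_
    obtain ⟨n, hn⟩ := hb.exists
    refine hn.trans ?_
    rw [← ofReal_integral_eq_lintegral_ofReal (e1 n) (ae_restrict_of_ae (hG0 n))]
    exact ENNReal.ofReal_le_ofReal (hle n)
  have hfin : CesaroFinite F := by
    filter_upwards [key] with x hx
    refine ⟨F.aestronglyMeasurable.restrict, ?_⟩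
    rw [hasFiniteIntegral_iff_ofReal (ae_restrict_of_ae hF0)]
    exact hx.2.2.trans_lt ENNReal.ofReal_lt_top
  refine ⟨hfin, ?_⟩
  filter_upwards [hfin, key, cesaro_coe F] with x e1 ⟨hx0, hx1, hx2⟩ e3
  have hx : (0 : ℝ) < x := lt_of_le_of_ne x.2.1 hx0.symm
  rw [← ofReal_integral_eq_lintegral_ofReal e1 (ae_restrict_of_ae hF0),
    ENNReal.ofReal_le_ofReal_iff hx1] at hx2
  rw [e3, inv_mul_le_iff₀ hx]
  exact hx2

/-- The main step towards `L¹(m_X) ⊆ [C, X]_a`. For `f ≥ 0` on `B`, the vectors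
`C (f χ_{B ∩ {f ≤ n}})` increase and converge weakly to `∫_B f dm_X`, so they converge in norm. -/
theorem mul_charClass_mem_acPart (hX : X.IsRISpace)
    (hne : (X.carrier : Set (I →ₘ[volume] ℝ)) ≠ (Lp ℝ ∞ (volume : Measure I) : Set _))
    {f : I →ₘ[volume] ℝ} (hf : VectorIntegrable (cesaroMeasure X hX hne) f) {B : Set I}
    (hB : MeasurableSet B) (hfB : ∀ x ∈ B, 0 ≤ f x) :
    f * charClass B hB ∈ (cesaroSpace X hX.toIsBanachFunctionSpace).acPart := by
  have hX' := hX.toIsBanachFunctionSpace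
  have hA : ∀ n : ℕ, MeasurableSet {x : I | |f x| ≤ n} := fun n =>
    measurableSet_le (continuous_abs.measurable.comp f.stronglyMeasurable.measurable)
      measurable_const
  have hcoe : ∀ᵐ x : I, ∀ n : ℕ, (f * charClass _ (hA n) : I →ₘ[volume] ℝ) x =
      {x : I | |f x| ≤ n}.indicator f x :=
    ae_all_iff.2 fun n => coeFn_mul_charClass f (hA n)
  have hbdd : ∀ n : ℕ, ∀ᵐ x : I, |(f * charClass _ (hA n) : I →ₘ[volume] ℝ) x| ≤ n := by
    intro n
    filter_upwards [hcoe] with x e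
    rw [e]
    by_cases hx : |f x| ≤ n
    · rwa [indicator_of_mem (by exact hx)]
    · simp [indicator_of_notMem (show x ∉ {x : I | |f x| ≤ n} from hx)]
  let h : ℕ → (cesaroSpace X hX').Elem := fun n =>
    (⟨f * charClass _ (hA n), cesaroSpace_bounded hX (hbdd n)⟩ : (cesaroSpace X hX').carrier)
  let H : ℕ → (cesaroSpace X hX').Elem := fun n => cesaroRestrict hX' hB (h n)
  have hac : ∀ n, (h n).1 ∈ (cesaroSpace X hX').acPart := fun n =>
    acPart_of_bounded hX hne (hbdd n)
  have hHac : ∀ n, (H n).1 ∈ (cesaroSpace X hX').acPart := fun n =>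
    acPart_mono hX' (hac n) (abs_mul_charClass_le _ hB)
  set F : I →ₘ[volume] ℝ := f * charClass B hB with hFdef
  have hFcoe : ∀ᵐ x : I, F x = B.indicator f x := coeFn_mul_charClass f hB
  have hHcoe : ∀ᵐ x : I, ∀ n : ℕ, (H n).1 x = {x : I | |f x| ≤ n}.indicator F x := by
    filter_upwards [hcoe, ae_all_iff.2 fun n => coeFn_mul_charClass (h n).1 hB, hFcoe]
      with x e1 e2 e3 n
    refine (e2 n).trans ?_
    by_cases hx : x ∈ B
    · rw [indicator_of_mem hx]
      refine (e1 n).trans ?_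
      by_cases hxn : x ∈ {x : I | |f x| ≤ n}
      · rw [indicator_of_mem hxn, indicator_of_mem hxn, e3, indicator_of_mem hx]
      · rw [indicator_of_notMem hxn, indicator_of_notMem hxn]
    · rw [indicator_of_notMem hx]
      by_cases hxn : x ∈ {x : I | |f x| ≤ n}
      · rw [indicator_of_mem hxn, e3, indicator_of_notMem hx]
      · rw [indicator_of_notMem hxn]
  have hF0 : ∀ᵐ x : I, 0 ≤ F x := by
    filter_upwards [hFcoe] with x e
    rw [e]
    exact indicator_nonneg hfB x
  have hH0 : ∀ n, ∀ᵐ x : I, 0 ≤ (H n).1 x := by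
    intro n
    filter_upwards [hHcoe, hF0] with x e1 e2
    rw [e1]
    exact indicator_apply_nonneg fun _ => e2
  have hHmono : ∀ m n, m ≤ n → ∀ᵐ x : I, (H m).1 x ≤ (H n).1 x := by
    intro m n hmn
    filter_upwards [hHcoe, hF0] with x e1 e2
    rw [e1, e1]
    have hsub : {x : I | |f x| ≤ m} ⊆ {x : I | |f x| ≤ n} := fun y hy =>
      le_trans (show |f y| ≤ m from hy) (Nat.cast_le.2 hmn)
    by_cases hx : x ∈ {x : I | |f x| ≤ m}
    · rw [indicator_of_mem hx, indicator_of_mem (hsub hx)]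
    · rw [indicator_of_notMem hx]
      exact indicator_apply_nonneg fun _ => e2
  have hHlim : ∀ᵐ x : I, Tendsto (fun n => (H n).1 x) atTop (𝓝 (F x)) := by
    filter_upwards [hHcoe] with x e
    obtain ⟨N, hN⟩ := exists_nat_ge |f x|
    refine tendsto_const_nhds.congr' ?_
    filter_upwards [eventually_ge_atTop N] with n hn
    rw [e, indicator_of_mem]
    exact hN.trans (Nat.cast_le.2 hn)
  have habs : ∀ (g : I →ₘ[volume] ℝ), (∀ᵐ x : I, 0 ≤ g x) → |g| = g := by
    intro g hg
    refine AEEqFun.ext ?_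
    filter_upwards [hg, AEEqFun.coeFn_abs g] with x e1 e2
    rw [e2, abs_of_nonneg e1]
  obtain ⟨v, hv⟩ := hf.2 B hB
  have hweak : ∀ φ : StrongDual ℝ X.Elem,
      Tendsto (fun n => φ (cesaroCLM X hX' (H n))) atTop (𝓝 (φ v)) := by
    intro φ
    rw [hv φ]
    have h1 : ∀ n, φ (cesaroCLM X hX' (H n)) =
        ∫ᵛ x in B, (h n).1 x ∂•(dualMeasure (cesaroMeasure X hX hne) φ) := fun n =>
      apply_cesaroCLM hX hne φ hB (h n) (hac n)
    simp only [h1]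
    have hacv := variation_dualMeasure_ac (cesaroMeasure_null hX hne) φ
    have hrestr : ((dualMeasure (cesaroMeasure X hX hne) φ).restrict B).variation ≪
        (volume : Measure I) := by
      rw [VectorMeasure.variation_restrict hB]
      exact Measure.restrict_le_self.absolutelyContinuous.trans hacv
    refine VectorMeasure.tendsto_integral_of_dominated_convergence (fun x => |f x|)
      (fun n => (h n).1.stronglyMeasurable.aestronglyMeasurable) ?_ (fun n => ?_) ?_
    · exact (VectorMeasure.Integrable.restrict (hf.1 φ)).abs
    · refine hrestr.ae_le ?_
      filter_upwards [hcoe] with x e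
      refine (le_of_eq (congrArg norm (e n))).trans ?_
      exact abs_indicator_le_abs _ _ _
    · refine hrestr.ae_le ?_
      filter_upwards [hcoe] with x e
      obtain ⟨N, hN⟩ := exists_nat_ge |f x|
      refine tendsto_const_nhds.congr' ?_
      filter_upwards [eventually_ge_atTop N] with n hn
      refine Eq.trans ?_ (e n).symm
      rw [indicator_of_mem]
      exact hN.trans (Nat.cast_le.2 hn)
  have hcmono : ∀ m n, m ≤ n →
      (cesaroCLM X hX' (H m)).1 ≤ᵐ[volume] (cesaroCLM X hX' (H n)).1 := by
    intro m n hmn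
    have h1 := cesaro_abs_mono (f := (H n).1) (g := (H m).1) (H n).2.1 (by
      filter_upwards [hHmono m n hmn, hH0 m, hH0 n] with x e1 e2 e3
      rwa [abs_of_nonneg e2, abs_of_nonneg e3])
    rw [habs _ (hH0 m), habs _ (hH0 n)] at h1
    exact h1
  obtain ⟨hub, hlim⟩ := tendsto_of_monotone_of_weak hX' (fun n => cesaroCLM X hX' (H n)) v
    hcmono hweak
  obtain ⟨hFfin, hFv⟩ := cesaro_le_of_tendsto (fun n => (H n).2.1) hH0 hF0 hHlim hub
  have hFabs := habs F hF0
  have hFX : cesaro |F| ∈ X.carrier := by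
    refine (hX'.ideal _ v.2 _ ?_).1
    rw [hFabs]
    filter_upwards [hFv, cesaro_abs_nonneg F] with x e1 e2
    rw [hFabs] at e2
    rw [abs_of_nonneg e2]
    exact e1.trans (le_abs_self _)
  let F' : (cesaroSpace X hX').Elem := (⟨F, hFfin, hFX⟩ : (cesaroSpace X hX').carrier)
  refine acPart_of_approx hX' F' fun ε hε => ?_
  obtain ⟨n, hn⟩ := ((Metric.tendsto_nhds.1 hlim) ε hε).exists
  refine ⟨H n, hHac n, lt_of_le_of_lt ?_ hn⟩
  rw [dist_comm, dist_eq_norm]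
  have hsub : |(F' - H n).1| = (F' - H n).1 := by
    refine habs _ ?_
    filter_upwards [AEEqFun.coeFn_sub F'.1 (H n).1, hHcoe, hF0] with x e1 e2 e3
    refine le_trans ?_ (le_of_eq e1.symm)
    rw [Pi.sub_apply, e2, sub_nonneg]
    exact indicator_apply_le' (fun _ => le_rfl) (fun _ => e3)
  show X.nrm (cesaro |(F' - H n).1|) ≤ X.nrm (v - cesaroCLM X hX' (H n)).1
  refine (hX'.ideal _ (v - cesaroCLM X hX' (H n)).2 _ ?_).2
  have hnn := cesaro_abs_nonneg (F' - H n).1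
  rw [hsub] at hnn ⊢
  have hceq : cesaro (F' - H n).1 = cesaro F - cesaro (H n).1 :=
    congrArg Subtype.val (map_sub (cesaroCLM X hX') F' (H n))
  rw [hceq] at hnn ⊢
  filter_upwards [hnn, AEEqFun.coeFn_sub (cesaro F) (cesaro (H n).1), hFv,
    AEEqFun.coeFn_sub v.1 (cesaroCLM X hX' (H n)).1] with x e1 e2 e3 e4
  rw [abs_of_nonneg e1, e2]
  refine le_trans ?_ (le_abs_self _)
  refine le_trans ?_ (le_of_eq e4.symm)
  exact sub_le_sub_right e3 _

/-- The elements of `L¹(m_X)` are those of `[C, X]_a`. -/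
theorem cesaroL1_carrier_eq (hX : X.IsRISpace)
    (hne : (X.carrier : Set (I →ₘ[volume] ℝ)) ≠ (Lp ℝ ∞ (volume : Measure I) : Set _)) :
    ((cesaroL1 X hX hne).carrier : Set (I →ₘ[volume] ℝ)) =
      (cesaroSpace X hX.toIsBanachFunctionSpace).acPart := by
  have hX' := hX.toIsBanachFunctionSpace
  refine Subset.antisymm (fun f hf => ?_) fun f hf => ?_
  · have hf' : VectorIntegrable (cesaroMeasure X hX hne) f := hf
    have hB : MeasurableSet {x : I | 0 ≤ f x} :=
      measurableSet_le measurable_const f.stronglyMeasurable.measurable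
    have h1 := mul_charClass_mem_acPart hX hne hf' hB fun x hx => hx
    have hneg : (-1 : ℝ) • f ∈ (cesaroL1 X hX hne).carrier :=
      (cesaroL1 X hX hne).carrier.smul_mem _ hf
    have hB' : MeasurableSet {x : I | 0 ≤ ((-1 : ℝ) • f) x} :=
      measurableSet_le measurable_const ((-1 : ℝ) • f).stronglyMeasurable.measurable
    have h2 := mul_charClass_mem_acPart hX hne hneg hB' fun x hx => hx
    have h3 := acPart_sub hX' (⟨_, h1.1⟩ : (cesaroSpace X hX').carrier)
      (⟨_, h2.1⟩ : (cesaroSpace X hX').carrier) h1 h2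
    refine acPart_mono hX' h3 (Eventually.mono ?_ fun x => le_of_eq)
    filter_upwards [coeFn_mul_charClass f hB, coeFn_mul_charClass ((-1 : ℝ) • f) hB',
      AEEqFun.coeFn_smul (-1 : ℝ) f, AEEqFun.coeFn_sub (f * charClass _ hB)
        (((-1 : ℝ) • f) * charClass _ hB')] with x e1 e2 e3 e4
    refine congrArg abs (Eq.trans ?_ e4.symm)
    rw [Pi.sub_apply, e1, e2]
    simp only [indicator_apply, mem_ofPred_eq, e3, Pi.smul_apply, smul_eq_mul]
    rcases lt_trichotomy (f x) 0 with hx | hx | hx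
    · rw [if_neg (not_le.2 hx), if_pos (by linarith)]
      ring
    · simp [hx]
    · rw [if_pos hx.le, if_neg (by linarith)]
      ring
  · let g : (cesaroSpace X hX').Elem := (⟨f, hf.1⟩ : (cesaroSpace X hX').carrier)
    exact ⟨fun φ => integrable_variation hX hne φ hf.1, fun A hA =>
      ⟨cesaroCLM X hX' (cesaroRestrict hX' hA g), fun φ => apply_cesaroCLM hX hne φ hA g hf⟩⟩

theorem cesaroL1_nrm_eq (hX : X.IsRISpace)
    (hne : (X.carrier : Set (I →ₘ[volume] ℝ)) ≠ (Lp ℝ ∞ (volume : Measure I) : Set _))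
    {f : I →ₘ[volume] ℝ} (hf : f ∈ (cesaroL1 X hX hne).carrier) :
    (cesaroL1 X hX hne).nrm f = (cesaroSpace X hX.toIsBanachFunctionSpace).nrm f := by
  have hf' : f ∈ (cesaroSpace X hX.toIsBanachFunctionSpace).acPart := by
    rw [← cesaroL1_carrier_eq hX hne]; exact hf
  show (vectorENorm (cesaroMeasure X hX hne) f).toReal = _
  rw [vectorENorm_eq hX hne hf',
    ENNReal.toReal_ofReal (NormedFunctionSpace.nrm_nonneg _ _ hf'.1)]

end VectorL1Eq

end

theorem theorem3p3 (X : NormedFunctionSpace (volume : Measure unitInterval))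
    (hX : X.IsRISpace)
    (hne : (X.carrier : Set (unitInterval →ₘ[volume] ℝ)) ≠
      (Lp ℝ ∞ (volume : Measure unitInterval) : Set (unitInterval →ₘ[volume] ℝ))) :
    -- neither of the two spaces is reflexive
    (¬ IsReflexive (cesaroL1 X hX hne).Elem ∧
      ¬ IsReflexive (cesaroSpace X hX.toIsBanachFunctionSpace).Elem) ∧
    -- `L¹(m_X)` is the absolutely continuous part of `[C, X]`, with the same norm
    (((cesaroL1 X hX hne).carrier : Set (unitInterval →ₘ[volume] ℝ)) =
        (cesaroSpace X hX.toIsBanachFunctionSpace).acPart ∧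
      ∀ f ∈ (cesaroL1 X hX hne).carrier,
        (cesaroL1 X hX hne).nrm f = (cesaroSpace X hX.toIsBanachFunctionSpace).nrm f) ∧
    -- neither of the two spaces is rearrangement invariant
    (¬ (cesaroSpace X hX.toIsBanachFunctionSpace).IsRearrangementInvariant ∧
      ¬ (cesaroL1 X hX hne).IsRearrangementInvariant) ∧
    -- nor does either of them have the same elements as some rearrangement invariant space
    ∀ Y : NormedFunctionSpace (volume : Measure unitInterval), Y.IsRISpace →
      Y.carrier ≠ (cesaroSpace X hX.toIsBanachFunctionSpace).carrier ∧
        Y.carrier ≠ (cesaroL1 X hX hne).carrier := by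
  have hX' := hX.toIsBanachFunctionSpace
  have hac := cesaroL1_carrier_eq hX hne
  have hle : (cesaroL1 X hX hne).carrier ≤ (cesaroSpace X hX').carrier := fun f hf => by
    have h : f ∈ (cesaroSpace X hX').acPart := by rw [← hac]; exact hf
    exact h.1
  have hge : (cesaroSpace X hX').acPart ⊆ (cesaroSpace X hX').carrier := fun f hf => hf.1
  refine ⟨⟨?_, cesaroSpace_not_isReflexive hX⟩, ⟨hac, fun f hf => cesaroL1_nrm_eq hX hne hf⟩,
    ⟨not_isRearrangementInvariant_of_between hX _ hge le_rfl,
      not_isRearrangementInvariant_of_between hX _ hac.ge hle⟩,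
    fun Y hY => ⟨fun h => ?_, fun h => ?_⟩⟩
  · refine not_isReflexive_of_subspace hX _ (fun f hf => ⟨hle hf, cesaroL1_nrm_eq hX hne hf⟩)
      fun A hA => ?_
    rw [← SetLike.mem_coe, hac]
    refine acPart_of_bounded hX hne (c := 1) ?_
    filter_upwards [charClass_coe (μ := volume) A hA] with x e
    rw [e]
    by_cases hx : x ∈ A <;> simp [hx]
  · exact not_isRearrangementInvariant_of_between hX Y (h ▸ hge) h.le hY.rearrangementInvariant
  · exact not_isRearrangementInvariant_of_between hX Y (h ▸ hac.ge) (h.le.trans hle)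
      hY.rearrangementInvariant
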